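/- Subsets $S_1,S_2,S_3$ of a finite set $S\subset\mathbb{R}^2$ are said to $k$-enclose a point $q$ if they are pairwise disjoint, each has size $k$, and for all $p_1\in S_1$, $p_2\in S_2$, $p_3\in S_3$ the point $q$ lies in the convex hull of $p_1,p_2,p_3$. The enclosing depth of $q$ with respect to $S$ is the maximum $k\ge 0$ such that some subsets $S_1,S_2,S_3$ of $S$ $k$-enclose $q$. Let $S\subset\mathbb{R}^2$ be a set of $n$ points and $q\in\mathbb{R}^2$ a point with $q\notin S$ such that no two distinct points of $S$ are collinear with $q$ (this holds in particular if $q\notin S$ and $S\cup\{q\}$ is in general position). Consider the following algorithm, whose input is $q$ and a list of the points of $S$ without repetitions, in any order. 1. Sort the points of $S$ radially around $q$ (by merge sort), giving a counter-clockwise order $s_0,\dots,s_{n-1}$; indices are read modulo $n$. Write $[s_a,s_b]$ for the interval of points from $s_a$ to $s_b$ in this cyclic order. 2. For each $s\in S$ compute by binary search the opposite neighbours $s^{(r)}$ and $s^{(\ell)}$, which are, in the cyclic radial order around $q$, the last point of $S$ before and the first point of $S$ after the direction opposite to $s$, respectively. 3. For an integer $k$, the subroutine does the following for each $s_i\in S$.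 With $s_j=s_i^{(r)}$ and $s_m=s_{i+k}^{(\ell)}$, it checks whether all eight triangles $a,b,c$ with $a\in\{s_i,s_{i+k}\}$, $b\in\{s_{j-k},s_j\}$, $c\in\{s_m,s_{m+k}\}$ contain $q$ and whether the three intervals $[s_i,s_{i+k}]$, $[s_{j-k},s_j]$, $[s_m,s_{m+k}]$ are pairwise disjoint. It returns TRUE if this holds for some $s_i$, and FALSE otherwise. 4. By a binary search over $k\in\{0,\dots,n\}$ with the subroutine as test, find the largest $k$ for which the subroutine returns TRUE, and return $k+1$; return $0$ if the search finds no such $k$. Then the algorithm returns the enclosing depth of $q$ with respect to $S$. Moreover, it runs in time $O(n\log n)$ on a real RAM, in which every arithmetic operation or comparison on real numbers or indices, every Boolean operation, every array access and every iteration or recursive call costs a constant number of steps: there is a constant $C$, independent of $S$, $q$ and the order of the input list, such that for $n\ge 2$ the number of steps is at most $C\,n\log n$. -/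

import Mathlib

/-- The Euclidean space `ℝ^d`. -/
abbrev Pt (d : ℕ) : Type := EuclideanSpace ℝ (Fin d)

/-! ### Enclosing depth -/

/-- The sets `T 0, …, T d` in `ℝ^d` `k`-enclose `q`: they are pairwise disjoint, each of size `k`,
and every transversal has `q` in its convex hull. -/
def KEncloses {d : ℕ} (k : ℕ) (T : Fin (d + 1) → Finset (Pt d)) (q : Pt d) : Prop :=
  (∀ i, (T i).card = k) ∧
  (∀ i j, i ≠ j → Disjoint (T i) (T j)) ∧
  ∀ p : Fin (d + 1) → Pt d, (∀ i, p i ∈ T i) → q ∈ convexHull ℝ (Set.range p)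

/-- The enclosing depth of `q` with respect to `S`: the maximum `k` such that some subsets of `S`
`k`-enclose `q`. -/
noncomputable def enclosingDepth {d : ℕ} (S : Finset (Pt d)) (q : Pt d) : ℕ :=
  sSup {k : ℕ | ∃ T : Fin (d + 1) → Finset (Pt d), (∀ i, T i ⊆ S) ∧ KEncloses k T q}

/-- The supremum in the definition of the enclosing depth is a maximum. -/
theorem enclosingDepth_isGreatest {d : ℕ} (S : Finset (Pt d)) (q : Pt d) :
    IsGreatest {k : ℕ | ∃ T : Fin (d + 1) → Finset (Pt d), (∀ i, T i ⊆ S) ∧ KEncloses k T q}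
      (enclosingDepth S q) := by
  have hb : BddAbove
      {k : ℕ | ∃ T : Fin (d + 1) → Finset (Pt d), (∀ i, T i ⊆ S) ∧ KEncloses k T q} := by
    refine ⟨S.card, ?_⟩
    rintro k ⟨T, hT, hk⟩
    rw [← hk.1 0]
    exact Finset.card_le_card (hT 0)
  have hne : Set.Nonempty
      {k : ℕ | ∃ T : Fin (d + 1) → Finset (Pt d), (∀ i, T i ⊆ S) ∧ KEncloses k T q} := by
    refine ⟨0, fun _ => ∅, fun _ => Finset.empty_subset _, ?_⟩
    refine ⟨fun _ => rfl, fun _ _ _ => Finset.disjoint_empty_left _, fun p hp => ?_⟩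
    exact absurd (hp 0) (Finset.notMem_empty _)
  exact ⟨Nat.sSup_mem hne hb, fun k hk => le_csSup hb hk⟩

/-! ### A real RAM with a step count

`Timed α` is a computation with a result of type `α` together with the number of elementary steps
that it performs.  Sequencing adds the numbers of steps.  The elementary steps of the real RAM are
the operations in the namespace `RAM`, each of which costs one step: arithmetic and comparisons of
real numbers, reading a coordinate, arithmetic and comparisons of indices, Boolean operations, and
reading an entry of an array or appending an entry.  A branch on a computed Boolean is part of the
step that computes it.  Loops and recursive calls pay for themselves by
explicit `RAM.tick`s. -/

/-- A computation: its result and its number of steps. -/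
structure Timed (α : Type) where
  val : α
  time : ℕ

instance : Monad Timed where
  pure a := ⟨a, 0⟩
  bind x f := ⟨(f x.val).val, x.time + (f x.val).time⟩

namespace RAM

/-- Spend `c` steps. -/
def tick (c : ℕ) : Timed Unit := ⟨(), c⟩

noncomputable def realSub (x y : ℝ) : Timed ℝ := ⟨x - y, 1⟩
noncomputable def realMul (x y : ℝ) : Timed ℝ := ⟨x * y, 1⟩
noncomputable def realLt (x y : ℝ) : Timed Bool := ⟨decide (x < y), 1⟩
noncomputable def coord {d : ℕ} (p : Pt d) (i : Fin d) : Timed ℝ := ⟨p i, 1⟩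

def natAdd (a b : ℕ) : Timed ℕ := ⟨a + b, 1⟩
def natSub (a b : ℕ) : Timed ℕ := ⟨a - b, 1⟩
def natMod (a b : ℕ) : Timed ℕ := ⟨a % b, 1⟩
def natLe (a b : ℕ) : Timed Bool := ⟨decide (a ≤ b), 1⟩

def boolAnd (a b : Bool) : Timed Bool := ⟨a && b, 1⟩
def boolOr (a b : Bool) : Timed Bool := ⟨a || b, 1⟩
def boolNot (a : Bool) : Timed Bool := ⟨!a, 1⟩

def arrayGet {α : Type} [Inhabited α] (A : Array α) (i : ℕ) : Timed α := ⟨A.getD i default, 1⟩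
def arrayPush {α : Type} (A : Array α) (a : α) : Timed (Array α) := ⟨A.push a, 1⟩
def arraySize {α : Type} (A : Array α) : Timed ℕ := ⟨A.size, 1⟩

/-- `for i = 0, …, n - 1 do s := body i s`; every iteration costs one step more than its body. -/
def forLoop {σ : Type} (body : ℕ → σ → Timed σ) (s : σ) : ℕ → Timed σ
  | 0 => do
      tick 1
      return s
  | n + 1 => do
      let s' ← forLoop body s n
      tick 1
      body n s'

end RAM

namespace PlanarDepth

open RAM

/-- A vector of the plane, stored as a pair of real numbers. -/
abbrev Vec : Type := ℝ × ℝ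

/-! ### Geometric primitives around the origin -/

/-- The determinant of `(u, v)`. -/
noncomputable def cross (u v : Vec) : Timed ℝ := do
  let a ← realMul u.1 v.2
  let b ← realMul u.2 v.1
  realSub a b

/-- Is `(u, v)` positively oriented? -/
noncomputable def ccw (u v : Vec) : Timed Bool := do
  let c ← cross u v
  realLt 0 c

/-- Is `(u, v)` negatively oriented? -/
noncomputable def cw (u v : Vec) : Timed Bool := do
  let c ← cross u v
  realLt c 0

/-- The vector `-u`. -/
noncomputable def opposite (u : Vec) : Timed Vec := do
  let x ← realSub 0 u.1
  let y ← realSub 0 u.2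
  return (x, y)

/-- Is the angle of `u ≠ 0` in `[0, π)`? -/
noncomputable def isUpper (u : Vec) : Timed Bool := do
  if ← realLt 0 u.2 then return true
  else if ← realLt u.2 0 then return false
  else realLt 0 u.1

/-- Does `u` come before `v` in the radial counter-clockwise order, with angles in `[0, 2π)`? -/
noncomputable def before (u v : Vec) : Timed Bool := do
  let hu ← isUpper u
  let hv ← isUpper v
  if hu then
    if hv then ccw u v else return true
  else
    if hv then return false else ccw u v

/-- Does the triangle `a b c` contain the origin (tested by the orientations of its edges)? -/
noncomputable def triangleTest (a b c : Vec) : Timed Bool := do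
  let l ← boolAnd (← boolAnd (← ccw a b) (← ccw b c)) (← ccw c a)
  let r ← boolAnd (← boolAnd (← cw a b) (← cw b c)) (← cw c a)
  boolOr l r

/-- Do both triangles `a b c` with `c ∈ {c₁, c₂}` contain the origin? -/
noncomputable def triangleTest₂ (a b c₁ c₂ : Vec) : Timed Bool := do
  boolAnd (← triangleTest a b c₁) (← triangleTest a b c₂)

/-- Do all four triangles `a b c` with `b ∈ {b₁, b₂}`, `c ∈ {c₁, c₂}` contain the origin? -/
noncomputable def triangleTest₄ (a b₁ b₂ c₁ c₂ : Vec) : Timed Bool := do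
  boolAnd (← triangleTest₂ a b₁ c₁ c₂) (← triangleTest₂ a b₂ c₁ c₂)

/-- Do all eight triangles `a b c` with `a ∈ {a₁, a₂}`, `b ∈ {b₁, b₂}`, `c ∈ {c₁, c₂}` contain the
origin? -/
noncomputable def triangleTest₈ (a₁ a₂ b₁ b₂ c₁ c₂ : Vec) : Timed Bool := do
  boolAnd (← triangleTest₄ a₁ b₁ b₂ c₁ c₂) (← triangleTest₄ a₂ b₁ b₂ c₁ c₂)

/-! ### Sorting and binary search -/

/-- Merge two lists that are sorted by `lt`. -/
def merge {α : Type} (lt : α → α → Timed Bool) : List α → List α → Timed (List α)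
  | [], ys => do
      tick 1
      return ys
  | x :: xs, [] => do
      tick 1
      return x :: xs
  | x :: xs, y :: ys => do
      tick 2
      if ← lt x y then
        let r ← merge lt xs (y :: ys)
        return x :: r
      else
        let r ← merge lt (x :: xs) ys
        return y :: r
termination_by xs ys => xs.length + ys.length

/-- Merge sort.  A call on a list of length `m` spends `2 * m + 2` steps on computing the length of
the list and on splitting the list in the middle. -/
def mergeSort {α : Type} (lt : α → α → Timed Bool) (l : List α) : Timed (List α) :=
  if l.length < 2 then do
    tick (2 * l.length + 2)
    return l
  else do
    tick (2 * l.length + 2)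
    let xs ← mergeSort lt (l.take (l.length / 2))
    let ys ← mergeSort lt (l.drop (l.length / 2))
    merge lt xs ys
termination_by l.length
decreasing_by
  · simp only [List.length_take]; omega
  · simp only [List.length_drop]; omega

/-- Binary search: for a monotone test (true up to some point and false from there on), the least
index in `[lo, hi)` at which the test is false, and `hi` if there is none.  Every round spends four
steps on comparing `lo` and `hi`, on the midpoint and on the new bound. -/
def binarySearch (test : ℕ → Timed Bool) (lo hi : ℕ) : Timed ℕ :=
  if lo < hi then do
    tick 4
    if ← test ((lo + hi) / 2) then
      binarySearch test ((lo + hi) / 2 + 1) hi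
    else
      binarySearch test lo ((lo + hi) / 2)
  else do
    tick 1
    return lo
termination_by hi - lo

/-! ### The algorithm -/

/-- The vectors `p - q` for the data points `p`. -/
noncomputable def centre (q : Pt 2) : List (Pt 2) → Timed (List Vec)
  | [] => do
      tick 1
      return []
  | p :: ps => do
      tick 2
      let x ← realSub (← coord p 0) (← coord q 0)
      let y ← realSub (← coord p 1) (← coord q 1)
      let vs ← centre q ps
      return (x, y) :: vs

/-- Store a list in an array. -/
def store {α : Type} (A : Array α) : List α → Timed (Array α)
  | [] => do
      tick 1
      return A
  | x :: xs => do
      tick 1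
      let B ← arrayPush A x
      store B xs

/-- The number of entries of the radially sorted array `A` that come before `w`, found by binary
search. -/
noncomputable def rank (A : Array Vec) (w : Vec) : Timed ℕ := do
  let n ← arraySize A
  binarySearch (fun t => do before (← arrayGet A t) w) 0 n

/-- The (cyclic) index of the last point of `A` before the opposite of the `i`-th point. -/
noncomputable def oppositeRight (A : Array Vec) (i : ℕ) : Timed ℕ := do
  let n ← arraySize A
  let r ← rank A (← opposite (← arrayGet A i))
  natMod (← natSub (← natAdd r n) 1) n

/-- The (cyclic) index of the first point of `A` after the opposite of the `i`-th point. -/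
noncomputable def oppositeLeft (A : Array Vec) (i : ℕ) : Timed ℕ := do
  let n ← arraySize A
  let r ← rank A (← opposite (← arrayGet A i))
  natMod r n

/-- Is the index `p` in the cyclic interval of indices from `a` to `b`? -/
def inInterval (a b p : ℕ) : Timed Bool := do
  if ← natLe a b then
    boolAnd (← natLe a p) (← natLe p b)
  else
    boolOr (← natLe a p) (← natLe p b)

/-- Are the cyclic intervals from `a₁` to `a₂` and from `b₁` to `b₂` disjoint?  It suffices to test
that neither of them contains the starting point of the other one. -/
def disjointIntervals (a₁ a₂ b₁ b₂ : ℕ) : Timed Bool := do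
  boolNot (← boolOr (← inInterval a₁ a₂ b₁) (← inInterval b₁ b₂ a₁))

/-- The check for one `i` of the subroutine with parameter `k`.  `A` is the radially sorted array,
`R` and `L` hold the indices of the opposite neighbours; with `j = R[i]` and `m = L[i + k]` the
intervals are `[i, i + k]`, `[j - k, j]` and `[m, m + k]`, with indices modulo `n`. -/
noncomputable def checkAt (A : Array Vec) (R L : Array ℕ) (k i : ℕ) : Timed Bool := do
  let n ← arraySize A
  let i' ← natMod (← natAdd i k) n
  let j ← arrayGet R i
  let j' ← natMod (← natSub (← natAdd j n) k) n
  let m ← arrayGet L i'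
  let m' ← natMod (← natAdd m k) n
  let d₁ ← disjointIntervals i i' j' j
  let d₂ ← disjointIntervals i i' m m'
  let d₃ ← disjointIntervals j' j m m'
  let t ← triangleTest₈ (← arrayGet A i) (← arrayGet A i') (← arrayGet A j') (← arrayGet A j)
    (← arrayGet A m) (← arrayGet A m')
  boolAnd (← boolAnd (← boolAnd d₁ d₂) d₃) t

/-- The subroutine: does the check succeed for some `i`? -/
noncomputable def subroutine (A : Array Vec) (R L : Array ℕ) (k : ℕ) : Timed Bool := do
  let n ← arraySize A
  forLoop (fun i found => do boolOr found (← checkAt A R L k i)) false n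

/-- The planar algorithm.  It sorts the points radially around `q`, computes all opposite
neighbours by binary search, and then runs a binary search over `k ∈ {0, …, n}` with the subroutine
as the test.  The result is `k + 1` for the largest `k` that the search finds to pass the test, and
`0` if it finds none. -/
noncomputable def algorithm (pts : List (Pt 2)) (q : Pt 2) : Timed ℕ := do
  let sorted ← mergeSort before (← centre q pts)
  let A ← store #[] sorted
  let n ← arraySize A
  let R ← forLoop (fun i R => do arrayPush R (← oppositeRight A i)) #[] n
  let L ← forLoop (fun i L => do arrayPush L (← oppositeLeft A i)) #[] n
  let hi ← natAdd n 1
  binarySearch (subroutine A R L) 0 hi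

end PlanarDepth

namespace Timed

variable {α β : Type}

@[simp] theorem val_bind (x : Timed α) (f : α → Timed β) : (x >>= f).val = (f x.val).val := rfl
@[simp] theorem time_bind (x : Timed α) (f : α → Timed β) :
    (x >>= f).time = x.time + (f x.val).time := rfl
@[simp] theorem val_pure (a : α) : (pure a : Timed α).val = a := rfl
@[simp] theorem time_pure (a : α) : (pure a : Timed α).time = 0 := rfl
@[simp] theorem val_ite (p : Prop) [Decidable p] (x y : Timed α) :
    (if p then x else y).val = if p then x.val else y.val := apply_ite _ _ _ _
@[simp] theorem time_ite (p : Prop) [Decidable p] (x y : Timed α) :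
    (if p then x else y).time = if p then x.time else y.time := apply_ite _ _ _ _

end Timed

namespace RAM

attribute [simp] tick realSub realMul realLt coord natAdd natSub natMod natLe boolAnd boolOr
  boolNot arrayGet arrayPush arraySize

theorem forLoop_time_le {σ : Type} (body : ℕ → σ → Timed σ) (s : σ) (c : ℕ)
    (h : ∀ i s, (body i s).time ≤ c) (n : ℕ) : (forLoop body s n).time ≤ n * (c + 1) + 1 := by
  induction n with
  | zero => simp [forLoop]
  | succ n ih =>
    simp only [forLoop, Timed.time_bind, tick]
    have := h n (forLoop body s n).val
    linarith

end RAM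

namespace PlanarDepth

open RAM

theorem isUpper_time_le (u : Vec) : (isUpper u).time ≤ 3 := by
  simp only [isUpper, Timed.time_bind, Timed.time_ite, realLt, Timed.time_pure]
  split_ifs <;> omega

theorem ccw_time (u v : Vec) : (ccw u v).time = 4 := by simp [ccw, cross]

theorem cw_time (u v : Vec) : (cw u v).time = 4 := by simp [cw, cross]

theorem before_time_le (u v : Vec) : (before u v).time ≤ 10 := by
  have hu := isUpper_time_le u
  have hv := isUpper_time_le v
  simp only [before, Timed.time_bind, Timed.time_ite, Timed.time_pure, ccw_time]
  split_ifs <;> omega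

theorem triangleTest_time (a b c : Vec) : (triangleTest a b c).time = 29 := by
  simp [triangleTest, ccw_time, cw_time]

theorem triangleTest₈_time (a₁ a₂ b₁ b₂ c₁ c₂ : Vec) :
    (triangleTest₈ a₁ a₂ b₁ b₂ c₁ c₂).time = 239 := by
  simp [triangleTest₈, triangleTest₄, triangleTest₂, triangleTest_time]

theorem inInterval_time (a b p : ℕ) : (inInterval a b p).time = 4 := by
  simp only [inInterval, natLe, boolAnd, boolOr, Timed.time_bind, Timed.time_ite]
  split_ifs <;> rfl

theorem disjointIntervals_time (a₁ a₂ b₁ b₂ : ℕ) :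
    (disjointIntervals a₁ a₂ b₁ b₂).time = 10 := by
  simp [disjointIntervals, inInterval_time]

theorem checkAt_time (A : Array Vec) (R L : Array ℕ) (k i : ℕ) :
    (checkAt A R L k i).time = 288 := by
  simp [checkAt, disjointIntervals_time, triangleTest₈_time]

theorem subroutine_time_le (A : Array Vec) (R L : Array ℕ) (k : ℕ) :
    (subroutine A R L k).time ≤ 290 * A.size + 2 := by
  have := forLoop_time_le
    (fun i found => do boolOr found (← checkAt A R L k i)) false 289
    (fun i s => by simp [checkAt_time]) A.size
  simp only [subroutine, Timed.time_bind, arraySize]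
  omega

theorem merge_time_le {α : Type} (lt : α → α → Timed Bool) (c : ℕ)
    (h : ∀ x y, (lt x y).time ≤ c) (xs ys : List α) :
    (merge lt xs ys).time ≤ (c + 2) * (xs.length + ys.length) + 1 := by
  fun_induction merge lt xs ys with
  | case1 ys => simp
  | case2 x xs => simp
  | case3 x xs y ys ih₁ ih₂ =>
    have hc := h x y
    simp only [Timed.time_bind, Timed.time_ite, tick, Timed.time_pure, List.length_cons] at *
    split_ifs <;> nlinarith

theorem mergeSort_time_le {α : Type} (lt : α → α → Timed Bool) (c : ℕ)
    (h : ∀ x y, (lt x y).time ≤ c) (l : List α)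
    (hlen : ∀ l : List α, (mergeSort lt l).val.length = l.length) :
    (mergeSort lt l).time ≤ (c + 7) * l.length * Nat.clog 2 l.length + 2 * l.length + 2 := by
  fun_induction mergeSort lt l with
  | case1 l hl => simp
  | case2 l hl ih₁ ih₂ =>
    have hm := merge_time_le lt c h (mergeSort lt (l.take (l.length / 2))).val
      (mergeSort lt (l.drop (l.length / 2))).val
    rw [hlen, hlen] at hm
    simp only [Timed.time_bind, tick, List.length_take, List.length_drop] at *
    obtain ⟨m, hlm⟩ : ∃ m, l.length = m := ⟨_, rfl⟩
    rw [hlm] at hm ih₁ ih₂ ⊢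
    have h2 : 2 ≤ m := by omega
    have hcl : Nat.clog 2 m = Nat.clog 2 ((m + 1) / 2) + 1 := by
      rw [Nat.clog_of_two_le (by norm_num) h2]
      congr 2
    have e1 : min (m / 2) m = m / 2 := by omega
    have e2 : m - m / 2 = (m + 1) / 2 := by omega
    rw [e1] at hm ih₁
    rw [e2] at hm ih₂
    set K := Nat.clog 2 ((m + 1) / 2)
    have hK : Nat.clog 2 (m / 2) ≤ K := Nat.clog_mono_right 2 (by omega)
    rw [hcl]
    have hs : m / 2 + (m + 1) / 2 = m := by omega
    rw [hs] at hm
    generalize m / 2 = x at *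
    have h3 : (c + 7) * x * Nat.clog 2 x ≤ (c + 7) * x * K := Nat.mul_le_mul_left _ hK
    have h4 : (c + 7) * x * K + (c + 7) * ((m + 1) / 2) * K = (c + 7) * m * K := by
      rw [← add_mul, ← mul_add, hs]
    rw [mul_add, mul_one]
    nlinarith

theorem binarySearch_time_le (test : ℕ → Timed Bool) (c : ℕ) (h : ∀ t, (test t).time ≤ c)
    (lo hi : ℕ) : (binarySearch test lo hi).time ≤ (c + 4) * Nat.clog 2 (hi - lo + 1) + 1 := by
  fun_induction binarySearch test lo hi with
  | case1 lo hi hlt ih₁ ih₂ =>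
    have hc := h ((lo + hi) / 2)
    have hcl : Nat.clog 2 (hi - lo + 1) = Nat.clog 2 ((hi - lo) / 2 + 1) + 1 := by
      rw [Nat.clog_of_two_le (by norm_num) (by omega)]
      congr 2
      omega
    have h1 : Nat.clog 2 (hi - ((lo + hi) / 2 + 1) + 1) ≤ Nat.clog 2 ((hi - lo) / 2 + 1) :=
      Nat.clog_mono_right 2 (by omega)
    have h2 : Nat.clog 2 ((lo + hi) / 2 - lo + 1) ≤ Nat.clog 2 ((hi - lo) / 2 + 1) :=
      Nat.clog_mono_right 2 (by omega)
    have h1' := Nat.mul_le_mul_left (c + 4) h1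
    have h2' := Nat.mul_le_mul_left (c + 4) h2
    simp only [Timed.time_bind, tick, Timed.time_ite]
    rw [hcl]
    split_ifs <;> linarith
  | case2 lo hi hlt => simp

theorem rank_time_le (A : Array Vec) (w : Vec) :
    (rank A w).time ≤ 15 * Nat.clog 2 (A.size + 1) + 2 := by
  have := binarySearch_time_le (fun t => do before (← arrayGet A t) w) 11
    (fun t => by
      have := before_time_le (A.getD t default) w
      simp only [Timed.time_bind, arrayGet]
      omega) 0 A.size
  simp only [rank, Timed.time_bind, arraySize]
  simp only [Nat.sub_zero] at this
  omega

theorem oppositeRight_time_le (A : Array Vec) (i : ℕ) :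
    (oppositeRight A i).time ≤ 15 * Nat.clog 2 (A.size + 1) + 9 := by
  have := rank_time_le A (opposite (A.getD i default)).val
  simp only [oppositeRight, Timed.time_bind, arraySize, arrayGet, natAdd, natSub, natMod]
  simp only [opposite, Timed.time_bind, realSub, Timed.time_pure] at *
  omega

theorem oppositeLeft_time_le (A : Array Vec) (i : ℕ) :
    (oppositeLeft A i).time ≤ 15 * Nat.clog 2 (A.size + 1) + 9 := by
  have := rank_time_le A (opposite (A.getD i default)).val
  simp only [oppositeLeft, Timed.time_bind, arraySize, arrayGet, natMod]
  simp only [opposite, Timed.time_bind, realSub, Timed.time_pure] at *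
  omega

theorem centre_time (q : Pt 2) (l : List (Pt 2)) : (centre q l).time = 8 * l.length + 1 := by
  induction l with
  | nil => simp [centre]
  | cons p ps ih => simp [centre, ih]; ring

theorem store_time {α : Type} (A : Array α) (l : List α) :
    (store A l).time = 2 * l.length + 1 := by
  induction l generalizing A with
  | nil => simp [store]
  | cons p ps ih => simp [store, ih]; ring

theorem centre_val (q : Pt 2) (l : List (Pt 2)) :
    (centre q l).val = l.map fun p => (p 0 - q 0, p 1 - q 1) := by
  induction l with
  | nil => simp [centre]
  | cons p ps ih => simp [centre, ih]

theorem store_val {α : Type} (A : Array α) (l : List α) :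
    (store A l).val = A ++ l.toArray := by
  induction l generalizing A with
  | nil => simp [store]
  | cons p ps ih => simp [store, ih]

/-! ### Sorting and searching -/

theorem merge_perm {α : Type} (lt : α → α → Timed Bool) (xs ys : List α) :
    (merge lt xs ys).val.Perm (xs ++ ys) := by
  fun_induction merge lt xs ys with
  | case1 ys => simp
  | case2 x xs => simp
  | case3 x xs y ys ih₁ ih₂ =>
    simp only [Timed.val_bind, Timed.val_ite, Timed.val_pure]
    split_ifs
    · exact ih₁.cons x
    · exact (ih₂.cons y).trans List.perm_middle.symm

theorem mergeSort_perm {α : Type} (lt : α → α → Timed Bool) (l : List α) :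
    (mergeSort lt l).val.Perm l := by
  fun_induction mergeSort lt l with
  | case1 l hl => simp
  | case2 l hl ih₁ ih₂ =>
    simp only [Timed.val_bind]
    refine (merge_perm _ _ _).trans ((ih₁.append ih₂).trans ?_)
    rw [List.take_append_drop]

theorem merge_pairwise {α : Type} (lt : α → α → Timed Bool) (key : α → ℝ) (xs ys : List α)
    (h : ∀ x ∈ xs, ∀ y ∈ ys, ((lt x y).val = true ↔ key x < key y))
    (hx : xs.Pairwise fun a b => key a ≤ key b) (hy : ys.Pairwise fun a b => key a ≤ key b) :
    (merge lt xs ys).val.Pairwise fun a b => key a ≤ key b := by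
  fun_induction merge lt xs ys with
  | case1 ys => simpa
  | case2 x xs => exact hx
  | case3 x xs y ys ih₁ ih₂ =>
    simp only [Timed.val_bind, Timed.val_ite, Timed.val_pure]
    have hxy := h x (by simp) y (by simp)
    rw [List.pairwise_cons] at hx hy
    split_ifs with hlt
    · refine List.pairwise_cons.2 ⟨fun z hz => ?_, ih₁ (fun a ha b hb => h a (by simp [ha]) b hb)
        hx.2 (List.pairwise_cons.2 hy)⟩
      rw [(merge_perm lt _ _).mem_iff, List.mem_append, List.mem_cons] at hz
      have := hxy.1 hlt
      rcases hz with hz | rfl | hz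
      · exact hx.1 z hz
      · exact this.le
      · exact this.le.trans (hy.1 z hz)
    · refine List.pairwise_cons.2 ⟨fun z hz => ?_, ih₂ (fun a ha b hb => h a ha b (by simp [hb]))
        (List.pairwise_cons.2 hx) hy.2⟩
      rw [(merge_perm lt _ _).mem_iff, List.mem_append, List.mem_cons] at hz
      have := not_lt.1 (mt hxy.2 hlt)
      rcases hz with (rfl | hz) | hz
      · exact this
      · exact this.trans (hx.1 z hz)
      · exact hy.1 z hz

theorem mergeSort_pairwise {α : Type} (lt : α → α → Timed Bool) (key : α → ℝ) (l : List α)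
    (h : ∀ x ∈ l, ∀ y ∈ l, ((lt x y).val = true ↔ key x < key y)) :
    (mergeSort lt l).val.Pairwise fun a b => key a ≤ key b := by
  fun_induction mergeSort lt l with
  | case1 l hl =>
    simp only [Timed.val_bind, Timed.val_pure]
    rcases l with _ | ⟨x, _ | ⟨y, l⟩⟩ <;> simp at hl ⊢
  | case2 l hl ih₁ ih₂ =>
    simp only [Timed.val_bind]
    refine merge_pairwise lt key _ _ (fun x hx y hy => ?_)
      (ih₁ fun x hx y hy => h x (List.mem_of_mem_take hx) y (List.mem_of_mem_take hy))
      (ih₂ fun x hx y hy => h x (List.mem_of_mem_drop hx) y (List.mem_of_mem_drop hy))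
    rw [(mergeSort_perm lt _).mem_iff] at hx hy
    exact h x (List.mem_of_mem_take hx) y (List.mem_of_mem_drop hy)

/-- Binary search finds the threshold of a monotone test. -/
theorem binarySearch_val (test : ℕ → Timed Bool) (lo hi r : ℕ) (hlo : lo ≤ r) (hhi : r ≤ hi)
    (h : ∀ t, lo ≤ t → t < hi → ((test t).val = true ↔ t < r)) :
    (binarySearch test lo hi).val = r := by
  fun_induction binarySearch test lo hi with
  | case1 lo hi hlt ih₁ ih₂ =>
    have hm := h ((lo + hi) / 2) (by omega) (by omega)
    simp only [Timed.val_bind, Timed.val_ite]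
    split_ifs with ht
    · have := hm.1 ht
      exact ih₁ (by omega) hhi fun t h1 h2 => h t (by omega) h2
    · have := mt hm.2 ht
      exact ih₂ hlo (by omega) fun t h1 h2 => h t h1 (by omega)
  | case2 lo hi hlt => simp; omega

theorem forLoop_push_val {α : Type} (f : ℕ → Timed α) (n : ℕ) :
    (forLoop (fun i R => do arrayPush R (← f i)) #[] n).val =
      Array.ofFn fun i : Fin n => (f i).val := by
  induction n with
  | zero => simp [forLoop]
  | succ n ih =>
    rw [Array.ofFn_succ]
    simp only [Fin.val_castSucc, ← ih]
    rfl

theorem forLoop_or_val (f : ℕ → Timed Bool) (n : ℕ) :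
    (forLoop (fun i found => do boolOr found (← f i)) false n).val = true ↔
      ∃ i < n, (f i).val = true := by
  induction n with
  | zero => simp [forLoop]
  | succ n ih =>
    simp only [boolOr] at ih
    simp only [forLoop, Timed.val_bind, boolOr, Bool.or_eq_true, ih, Nat.lt_succ_iff_lt_or_eq]
    constructor
    · rintro (⟨i, hi, h⟩ | h)
      exacts [⟨i, .inl hi, h⟩, ⟨n, .inr rfl, h⟩]
    · rintro ⟨i, hi | rfl, h⟩
      exacts [.inl ⟨i, hi, h⟩, .inr h]

/-! ### Polar angles -/

/-- The vector `u` is nonzero and `θ` is one of its polar angles. -/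
def HasAngle (u : Vec) (θ : ℝ) : Prop :=
  ∃ r > 0, u = (r * Real.cos θ, r * Real.sin θ)

theorem HasAngle.add_int_mul {u : Vec} {θ : ℝ} (h : HasAngle u θ) (k : ℤ) :
    HasAngle u (θ + k * (2 * Real.pi)) := by
  obtain ⟨r, hr, rfl⟩ := h
  exact ⟨r, hr, by rw [Real.cos_add_int_mul_two_pi, Real.sin_add_int_mul_two_pi]⟩

theorem exists_hasAngle (u : Vec) (hu : u ≠ 0) :
    ∃ θ, 0 ≤ θ ∧ θ < 2 * Real.pi ∧ HasAngle u θ := by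
  have h0 : (⟨u.1, u.2⟩ : ℂ) ≠ 0 := fun h => hu (by
    rw [Complex.ext_iff] at h
    exact Prod.ext h.1 h.2)
  have hang : HasAngle u (Complex.arg ⟨u.1, u.2⟩) :=
    ⟨_, norm_pos_iff.2 h0, Prod.ext (Complex.norm_mul_cos_arg ⟨u.1, u.2⟩).symm
      (Complex.norm_mul_sin_arg ⟨u.1, u.2⟩).symm⟩
  have h1 := Complex.neg_pi_lt_arg ⟨u.1, u.2⟩
  have h2 := Complex.arg_le_pi ⟨u.1, u.2⟩
  rcases lt_or_ge (Complex.arg ⟨u.1, u.2⟩) 0 with h | h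
  · refine ⟨_, ?_, ?_, hang.add_int_mul 1⟩ <;> push_cast <;> linarith
  · exact ⟨_, h, by linarith [Real.pi_pos], hang⟩

theorem HasAngle.opposite {u : Vec} {θ : ℝ} (h : HasAngle u θ) :
    HasAngle (opposite u).val (θ + Real.pi) := by
  obtain ⟨r, hr, rfl⟩ := h
  exact ⟨r, hr, by simp [PlanarDepth.opposite]⟩

theorem HasAngle.cross {u v : Vec} {θ φ : ℝ} (hu : HasAngle u θ) (hv : HasAngle v φ) :
    ∃ c > 0, u.1 * v.2 - u.2 * v.1 = c * Real.sin (φ - θ) := by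
  obtain ⟨r, hr, rfl⟩ := hu
  obtain ⟨s, hs, rfl⟩ := hv
  exact ⟨r * s, mul_pos hr hs, by rw [Real.sin_sub]; ring⟩

theorem ccw_val (u v : Vec) : (ccw u v).val = true ↔ 0 < u.1 * v.2 - u.2 * v.1 := by
  simp [ccw, PlanarDepth.cross]

theorem cw_val (u v : Vec) : (cw u v).val = true ↔ u.1 * v.2 - u.2 * v.1 < 0 := by
  simp [cw, PlanarDepth.cross]

theorem HasAngle.ccw_iff {u v : Vec} {θ φ : ℝ} (hu : HasAngle u θ) (hv : HasAngle v φ) :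
    (ccw u v).val = true ↔ 0 < Real.sin (φ - θ) := by
  obtain ⟨c, hc, h⟩ := hu.cross hv
  rw [ccw_val, h, mul_pos_iff_of_pos_left hc]

theorem HasAngle.cw_iff {u v : Vec} {θ φ : ℝ} (hu : HasAngle u θ) (hv : HasAngle v φ) :
    (cw u v).val = true ↔ Real.sin (φ - θ) < 0 := by
  obtain ⟨c, hc, h⟩ := hu.cross hv
  rw [cw_val, h, mul_neg_iff]
  simp [hc, hc.not_gt]

theorem sin_pos_iff_lt_pi {x : ℝ} (h₀ : 0 < x) (h₁ : x < 2 * Real.pi) :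
    0 < Real.sin x ↔ x < Real.pi := by
  refine ⟨fun h => ?_, Real.sin_pos_of_pos_of_lt_pi h₀⟩
  by_contra! hx
  have := Real.sin_nonneg_of_nonneg_of_le_pi (x := x - Real.pi) (by linarith) (by linarith)
  rw [Real.sin_sub_pi] at this
  linarith

theorem sin_neg_iff_pi_lt {x : ℝ} (h₀ : 0 < x) (h₁ : x < 2 * Real.pi) :
    Real.sin x < 0 ↔ Real.pi < x := by
  refine ⟨fun h => ?_, fun h => ?_⟩
  · by_contra! hx
    linarith [Real.sin_nonneg_of_nonneg_of_le_pi h₀.le hx]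
  · have := Real.sin_pos_of_pos_of_lt_pi (x := x - Real.pi) (by linarith) (by linarith)
    rw [Real.sin_sub_pi] at this
    linarith

theorem HasAngle.isUpper_iff {u : Vec} {θ : ℝ} (hu : HasAngle u θ) (h₀ : 0 ≤ θ)
    (h₁ : θ < 2 * Real.pi) : (isUpper u).val = true ↔ θ < Real.pi := by
  have hu2 : (isUpper u).val = true ↔ 0 < u.2 ∨ (u.2 = 0 ∧ 0 < u.1) := by
    simp only [isUpper, Timed.val_bind, Timed.val_ite, Timed.val_pure, realLt, decide_eq_true_eq]
    rcases lt_trichotomy u.2 0 with h | h | h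
    · simp [h, h.not_gt, h.ne]
    · simp [h]
    · simp [h]
  rw [hu2]
  obtain ⟨r, hr, rfl⟩ := hu
  have hpi := Real.pi_pos
  simp only [mul_pos_iff_of_pos_left hr, mul_eq_zero, hr.ne', false_or]
  rcases h₀.eq_or_lt with rfl | h₀
  · simp [hpi]
  · rw [sin_pos_iff_lt_pi h₀ h₁, or_iff_left_iff_imp]
    rintro ⟨h2, h3⟩
    have h4 : θ = Real.pi := by
      by_contra hne
      rcases lt_or_gt_of_ne hne with h | h
      · exact (Real.sin_pos_of_pos_of_lt_pi h₀ h).ne' h2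
      · exact ((sin_neg_iff_pi_lt h₀ h₁).2 h).ne h2
    rw [h4, Real.cos_pi] at h3
    linarith

theorem HasAngle.before_iff {u v : Vec} {θ φ : ℝ} (hu : HasAngle u θ) (hv : HasAngle v φ)
    (hθ₀ : 0 ≤ θ) (hθ₁ : θ < 2 * Real.pi) (hφ₀ : 0 ≤ φ) (hφ₁ : φ < 2 * Real.pi) :
    (before u v).val = true ↔ θ < φ := by
  have h1 := hu.isUpper_iff hθ₀ hθ₁
  have h2 := hv.isUpper_iff hφ₀ hφ₁
  have key : |φ - θ| < Real.pi → (0 < Real.sin (φ - θ) ↔ θ < φ) := by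
    intro h
    rw [abs_lt] at h
    constructor
    · intro hs
      by_contra! hle
      linarith [Real.sin_nonpos_of_nonpos_of_neg_pi_le (x := φ - θ) (by linarith) h.1.le]
    · intro hlt
      exact Real.sin_pos_of_pos_of_lt_pi (by linarith) h.2
  simp only [before, Timed.val_bind, Timed.val_ite, Timed.val_pure, h1, h2]
  split_ifs with hl hr hr
  · rw [hu.ccw_iff hv, key (abs_lt.2 ⟨by linarith, by linarith⟩)]
  · simp only [true_iff]; linarith
  · simp only [false_iff]; linarith
  · rw [hu.ccw_iff hv, key (abs_lt.2 ⟨by linarith, by linarith⟩)]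

theorem triangleTest_val (a b c : Vec) : (triangleTest a b c).val = true ↔
    ((ccw a b).val = true ∧ (ccw b c).val = true ∧ (ccw c a).val = true) ∨
    ((cw a b).val = true ∧ (cw b c).val = true ∧ (cw c a).val = true) := by
  simp [triangleTest, and_assoc]

theorem triangleTest_swap (a b c : Vec) :
    (triangleTest a c b).val = true ↔ (triangleTest a b c).val = true := by
  have h : ∀ x y : Vec, x.1 * y.2 - x.2 * y.1 = -(y.1 * x.2 - y.2 * x.1) := by intros; ring
  simp only [triangleTest_val, ccw_val, cw_val]
  rw [h a c, h c b, h b a]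
  simp only [neg_pos, neg_lt_zero]
  tauto

/-- A triangle contains the origin if and only if the gaps between the polar angles of its
vertices are less than `π`. -/
theorem HasAngle.triangleTest_iff {a b c : Vec} {x y z : ℝ} (ha : HasAngle a x)
    (hb : HasAngle b y) (hc : HasAngle c z) (hxy : x < y) (hyz : y < z)
    (hzx : z < x + 2 * Real.pi) : (triangleTest a b c).val = true ↔
      y - x < Real.pi ∧ z - y < Real.pi ∧ x + 2 * Real.pi - z < Real.pi := by
  have e : Real.sin (x - z) = Real.sin (x + 2 * Real.pi - z) := by
    rw [← Real.sin_add_two_pi (x - z)]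
    ring_nf
  rw [triangleTest_val, ha.ccw_iff hb, hb.ccw_iff hc, hc.ccw_iff ha, ha.cw_iff hb, hb.cw_iff hc,
    hc.cw_iff ha, e, sin_pos_iff_lt_pi, sin_pos_iff_lt_pi, sin_pos_iff_lt_pi, sin_neg_iff_pi_lt,
    sin_neg_iff_pi_lt, sin_neg_iff_pi_lt, or_iff_left_iff_imp]
  any_goals linarith
  rintro ⟨h1, h2, h3⟩
  linarith

theorem triangleTest₈_val (a₁ a₂ b₁ b₂ c₁ c₂ : Vec) :
    (triangleTest₈ a₁ a₂ b₁ b₂ c₁ c₂).val = true ↔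
      ∀ a, (a = a₁ ∨ a = a₂) → ∀ b, (b = b₁ ∨ b = b₂) → ∀ c, (c = c₁ ∨ c = c₂) →
        (triangleTest a b c).val = true := by
  simp only [triangleTest₈, triangleTest₄, triangleTest₂, Timed.val_bind, boolAnd,
    Bool.and_eq_true, forall_eq_or_imp, forall_eq]

/-! ### Triangles and convex hulls -/

/-- The vector from `q` to `p`. -/
noncomputable def vec (q p : Pt 2) : Vec := (p 0 - q 0, p 1 - q 1)

theorem mem_convexHull_range_iff {d : ℕ} (p : Fin 3 → Pt d) (q : Pt d) :
    q ∈ convexHull ℝ (Set.range p) ↔ ∃ w : Fin 3 → ℝ, (∀ i, 0 ≤ w i) ∧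
      w 0 + w 1 + w 2 = 1 ∧ ∀ j, w 0 * p 0 j + w 1 * p 1 j + w 2 * p 2 j = q j := by
  constructor
  · intro hq
    have hsub : convexHull ℝ (Set.range p) ⊆ {x | ∃ w : Fin 3 → ℝ, (∀ i, 0 ≤ w i) ∧
        w 0 + w 1 + w 2 = 1 ∧ ∀ j, w 0 * p 0 j + w 1 * p 1 j + w 2 * p 2 j = x j} := by
      refine convexHull_min ?_ ?_
      · rintro _ ⟨i, rfl⟩
        refine ⟨Pi.single i 1, fun j => ?_, ?_, fun j => ?_⟩
        · have h1 : (0 : Fin 3 → ℝ) ≤ Pi.single i 1 := Pi.single_nonneg.2 zero_le_one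
          exact h1 j
        · fin_cases i <;> simp
        · fin_cases i <;> simp
      · rintro x ⟨u, hu, hus, hux⟩ y ⟨v, hv, hvs, hvy⟩ a b ha hb hab
        refine ⟨fun i => a * u i + b * v i, fun i => ?_, ?_, fun j => ?_⟩
        · exact add_nonneg (mul_nonneg ha (hu i)) (mul_nonneg hb (hv i))
        · linear_combination a * hus + b * hvs + hab
        · simp only [PiLp.add_apply, PiLp.smul_apply, smul_eq_mul]
          linear_combination a * hux j + b * hvy j
    exact hsub hq
  · rintro ⟨w, hw, hs, hq⟩
    refine mem_convexHull_of_exists_fintype w p hw ?_ Set.mem_range_self ?_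
    · rw [Fin.sum_univ_three, hs]
    · ext j
      rw [← hq j, Fin.sum_univ_three]
      simp

theorem mem_convexHull_range_iff_triangleTest (p : Fin 3 → Pt 2) (q : Pt 2)
    (h : ∀ i j, i ≠ j →
      (vec q (p i)).1 * (vec q (p j)).2 - (vec q (p i)).2 * (vec q (p j)).1 ≠ 0) :
    q ∈ convexHull ℝ (Set.range p) ↔
      (triangleTest (vec q (p 0)) (vec q (p 1)) (vec q (p 2))).val = true := by
  rw [mem_convexHull_range_iff, triangleTest_val]
  simp only [ccw_val, cw_val]
  have h01 := h 0 1 (by decide)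
  have h12 := h 1 2 (by decide)
  have h20 := h 2 0 (by decide)
  set x := (vec q (p 0)).1 * (vec q (p 1)).2 - (vec q (p 0)).2 * (vec q (p 1)).1 with hx
  set y := (vec q (p 1)).1 * (vec q (p 2)).2 - (vec q (p 1)).2 * (vec q (p 2)).1 with hy
  set z := (vec q (p 2)).1 * (vec q (p 0)).2 - (vec q (p 2)).2 * (vec q (p 0)).1 with hz
  simp only [vec] at hx hy hz
  constructor
  · rintro ⟨w, hw, hs, hq⟩
    have q0 := hq 0
    have q1 := hq 1
    have e1 : w 1 * x = w 2 * z := by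
      rw [hx, hz]
      linear_combination (p 0 0 - q 0) * q1 - (p 0 1 - q 1) * q0 +
        ((p 0 1 - q 1) * q 0 - (p 0 0 - q 0) * q 1) * hs
    have e2 : w 2 * y = w 0 * x := by
      rw [hx, hy]
      linear_combination (p 1 0 - q 0) * q1 - (p 1 1 - q 1) * q0 +
        ((p 1 1 - q 1) * q 0 - (p 1 0 - q 0) * q 1) * hs
    have e3 : w 0 * z = w 1 * y := by
      rw [hy, hz]
      linear_combination (p 2 0 - q 0) * q1 - (p 2 1 - q 1) * q0 +
        ((p 2 1 - q 1) * q 0 - (p 2 0 - q 0) * q 1) * hs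
    have w0 : 0 < w 0 := by
      refine (hw 0).lt_of_ne' fun h0 => ?_
      have z2 : w 2 = 0 := by simpa [h0, h12] using e2
      have z1 : w 1 = 0 := by simpa [h0, h12] using e3.symm
      linarith
    have w1 : 0 < w 1 := by
      refine (hw 1).lt_of_ne' fun h0 => ?_
      have z2 : w 2 = 0 := by simpa [h0, h20] using e1.symm
      have z0 : w 0 = 0 := by simpa [h0, h20] using e3
      linarith
    have w2 : 0 < w 2 := by
      refine (hw 2).lt_of_ne' fun h0 => ?_
      have z1 : w 1 = 0 := by simpa [h0, h01] using e1
      have z0 : w 0 = 0 := by simpa [h0, h01] using e2.symm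
      linarith
    rcases lt_or_gt_of_ne h01 with hlt | hlt
    · right
      exact ⟨hlt, neg_of_mul_neg_right (e2 ▸ mul_neg_of_pos_of_neg w0 hlt) w2.le,
        neg_of_mul_neg_right (e1 ▸ mul_neg_of_pos_of_neg w1 hlt) w2.le⟩
    · left
      exact ⟨hlt, pos_of_mul_pos_right (e2 ▸ mul_pos w0 hlt) w2.le,
        pos_of_mul_pos_right (e1 ▸ mul_pos w1 hlt) w2.le⟩
  · intro hor
    have hs : x + y + z ≠ 0 ∧ 0 ≤ y / (x + y + z) ∧ 0 ≤ z / (x + y + z) ∧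
        0 ≤ x / (x + y + z) := by
      rcases hor with ⟨h1, h2, h3⟩ | ⟨h1, h2, h3⟩
      · exact ⟨by positivity, by positivity, by positivity, by positivity⟩
      · have : x + y + z ≤ 0 := by linarith
        exact ⟨by linarith, div_nonneg_of_nonpos h2.le this, div_nonneg_of_nonpos h3.le this,
          div_nonneg_of_nonpos h1.le this⟩
    obtain ⟨hs, hy0, hz0, hx0⟩ := hs
    refine ⟨![y / (x + y + z), z / (x + y + z), x / (x + y + z)], ?_, ?_, ?_⟩
    · intro i
      fin_cases i
      exacts [hy0, hz0, hx0]
    · simp only [Matrix.cons_val]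
      field_simp
      ring
    · intro j
      simp only [Matrix.cons_val]
      field_simp
      rw [hx, hy, hz]
      fin_cases j <;> simp <;> ring

/-! ### Cyclic arrays of vectors sorted by angle -/

/-- The entry of `A` at the cyclic index `t`. -/
noncomputable def entry (A : Array Vec) (t : ℤ) : Vec := A.getD (t % A.size).toNat default

theorem entry_emod (A : Array Vec) (t : ℤ) : entry A (t % A.size) = entry A t := by
  simp [entry]

theorem entry_eq_of_emod_eq (A : Array Vec) {s t : ℤ} (h : s % A.size = t % A.size) :
    entry A s = entry A t := by
  rw [← entry_emod, h, entry_emod]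

theorem entry_natCast (A : Array Vec) {i : ℕ} (hi : i < A.size) :
    A.getD i default = entry A i := by
  rw [entry, ← Int.natCast_mod, Int.toNat_natCast, Nat.mod_eq_of_lt hi]

/-- The entries of `A` are in radial order, with angles `α 0 < … < α (n - 1)` in `[0, 2π)`;
`α` is extended quasi-periodically to all integers.  No two entries are parallel. -/
structure IsRadial (A : Array Vec) (α : ℤ → ℝ) : Prop where
  pos : 0 < A.size
  strictMono : StrictMono α
  add_size : ∀ t, α (t + A.size) = α t + 2 * Real.pi
  nonneg : 0 ≤ α 0
  lt_two_pi : α (A.size - 1) < 2 * Real.pi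
  hasAngle : ∀ t, HasAngle (entry A t) (α t)
  inj : ∀ s t, entry A s = entry A t → s % A.size = t % A.size
  ne_opposite : ∀ s t, α t ≠ α s + Real.pi

/-- `m` is the first index after the direction opposite to the `i`-th entry. -/
def IsOpposite (α : ℤ → ℝ) (i m : ℤ) : Prop :=
  α (m - 1) < α i + Real.pi ∧ α i + Real.pi < α m

/-- The index intervals of length `k` starting at `a`, `b`, `c` are disjoint and in cyclic order,
and the gaps of their corner triangles are less than `π`. -/
structure GoodTriple (n k : ℕ) (α : ℤ → ℝ) (a b c : ℤ) : Prop where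
  lt₁ : a + k < b
  lt₂ : b + k < c
  lt₃ : c + k < a + n
  gap₁ : α (b + k) - α a < Real.pi
  gap₂ : α (c + k) - α b < Real.pi
  gap₃ : α (a + k) + 2 * Real.pi - α c < Real.pi

/-- The condition checked by the subroutine for intervals starting at `a`, `b`, `c`. -/
def CheckTriple (A : Array Vec) (k : ℕ) (a b c : ℤ) : Prop :=
  ((k < (b - a) % A.size ∧ k < (a - b) % A.size) ∧
    (k < (c - a) % A.size ∧ k < (a - c) % A.size) ∧
    (k < (c - b) % A.size ∧ k < (b - c) % A.size)) ∧
  ∀ u, (u = entry A a ∨ u = entry A (a + k)) → ∀ v, (v = entry A b ∨ v = entry A (b + k)) →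
    ∀ w, (w = entry A c ∨ w = entry A (c + k)) → (triangleTest u v w).val = true

theorem CheckTriple.congr {A : Array Vec} {k : ℕ} {a b c a' b' c' : ℤ}
    (h : CheckTriple A k a b c) (ha : a % A.size = a' % A.size) (hb : b % A.size = b' % A.size)
    (hc : c % A.size = c' % A.size) : CheckTriple A k a' b' c' := by
  have hs : ∀ {x y x' y' : ℤ}, x % A.size = x' % A.size → y % A.size = y' % A.size →
      (x - y) % A.size = (x' - y') % A.size := fun h1 h2 => Int.ModEq.sub h1 h2
  have he : ∀ {x x' : ℤ}, x % A.size = x' % A.size →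
      entry A x = entry A x' ∧ entry A (x + k) = entry A (x' + k) := fun h1 =>
    ⟨entry_eq_of_emod_eq A h1, entry_eq_of_emod_eq A (Int.ModEq.add_right _ h1)⟩
  unfold CheckTriple at *
  rwa [hs hb ha, hs ha hb, hs hc ha, hs ha hc, hs hc hb, hs hb hc, (he ha).1, (he ha).2,
    (he hb).1, (he hb).2, (he hc).1, (he hc).2] at h

theorem CheckTriple.swap {A : Array Vec} {k : ℕ} {a b c : ℤ} (h : CheckTriple A k a b c) :
    CheckTriple A k a c b := by
  obtain ⟨⟨h1, h2, h3⟩, h4⟩ := h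
  exact ⟨⟨h2, h1, h3.2, h3.1⟩, fun u hu v hv w hw =>
    (triangleTest_swap _ _ _).1 (h4 u hu w hw v hv)⟩

namespace IsRadial

variable {A : Array Vec} {α : ℤ → ℝ} (h : IsRadial A α)
include h

theorem sub_size (t : ℤ) : α (t - A.size) = α t - 2 * Real.pi := by
  have := h.add_size (t - A.size)
  rw [sub_add_cancel] at this
  linarith

theorem add_mul_size (t s : ℤ) : α (t + s * A.size) = α t + s * (2 * Real.pi) := by
  induction s using Int.induction_on with
  | zero => simp
  | succ i ih =>
    have := h.add_size (t + i * A.size)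
    rw [ih] at this
    rw [add_mul, one_mul, ← add_assoc, this]
    push_cast
    ring
  | pred i ih =>
    have := h.sub_size (t + -i * A.size)
    rw [ih] at this
    rw [sub_mul, one_mul, ← add_sub_assoc, this]
    push_cast
    ring

theorem triangleTest_iff {a b c : ℤ} (hab : a < b) (hbc : b < c) (hca : c < a + A.size) :
    (triangleTest (entry A a) (entry A b) (entry A c)).val = true ↔
      α b - α a < Real.pi ∧ α c - α b < Real.pi ∧ α a + 2 * Real.pi - α c < Real.pi := by
  refine (h.hasAngle a).triangleTest_iff (h.hasAngle b) (h.hasAngle c) (h.strictMono hab)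
    (h.strictMono hbc) ?_
  rw [← h.add_size]
  exact h.strictMono hca

theorem triangleTest_of_goodTriple {k : ℕ} {a b c : ℤ} (hg : GoodTriple A.size k α a b c)
    {x y z : ℤ} (hx : x ∈ Finset.Icc a (a + k)) (hy : y ∈ Finset.Icc b (b + k))
    (hz : z ∈ Finset.Icc c (c + k)) :
    (triangleTest (entry A x) (entry A y) (entry A z)).val = true := by
  obtain ⟨h1, h2, h3, g1, g2, g3⟩ := hg
  rw [Finset.mem_Icc] at hx hy hz
  have hm := h.strictMono.monotone
  have := hm hx.1
  have := hm hx.2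
  have := hm hy.1
  have := hm hy.2
  have := hm hz.1
  have := hm hz.2
  exact (h.triangleTest_iff (by omega) (by omega) (by omega)).2
    ⟨by linarith, by linarith, by linarith⟩

theorem checkTriple_of_goodTriple {k : ℕ} {a b c : ℤ} (hg : GoodTriple A.size k α a b c) :
    CheckTriple A k a b c := by
  have ⟨h1, h2, h3, _, _, _⟩ := hg
  have e1 : ∀ x : ℤ, k < x → x < A.size - k → k < x % A.size ∧ k < (-x) % A.size := by
    intro x hx hx'
    rw [Int.emod_eq_of_lt (by omega) (by omega), ← Int.add_emod_right,
      Int.emod_eq_of_lt (by omega) (by omega)]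
    omega
  refine ⟨⟨?_, ?_, ?_⟩, fun u hu v hv w hw => ?_⟩
  · rw [← neg_sub b a]; exact e1 _ (by omega) (by omega)
  · rw [← neg_sub c a]; exact e1 _ (by omega) (by omega)
  · rw [← neg_sub c b]; exact e1 _ (by omega) (by omega)
  · rcases hu with rfl | rfl <;> rcases hv with rfl | rfl <;> rcases hw with rfl | rfl <;>
      refine h.triangleTest_of_goodTriple hg ?_ ?_ ?_ <;> simp

theorem goodTriple_of_checkTriple_of_lt {k : ℕ} {a b c : ℤ} (hc : CheckTriple A k a b c)
    (h1 : a + k < b) (h2 : b + k < c) (h3 : c + k < a + A.size) :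
    GoodTriple A.size k α a b c := by
  have ht := hc.2
  have t1 := (h.triangleTest_iff (a := a) (b := b + k) (c := c) (by omega) (by omega)
    (by omega)).1 (ht _ (.inl rfl) _ (.inr rfl) _ (.inl rfl))
  have t2 := (h.triangleTest_iff (a := a) (b := b) (c := c + k) (by omega) (by omega)
    (by omega)).1 (ht _ (.inl rfl) _ (.inl rfl) _ (.inr rfl))
  have t3 := (h.triangleTest_iff (a := a + k) (b := b) (c := c) (by omega) (by omega)
    (by omega)).1 (ht _ (.inr rfl) _ (.inl rfl) _ (.inl rfl))
  exact ⟨h1, h2, h3, t1.1, t2.2.1, t3.2.2⟩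

theorem exists_goodTriple_of_checkTriple {k : ℕ} {a b c : ℤ} (hc : CheckTriple A k a b c) :
    ∃ a b c, GoodTriple A.size k α a b c := by
  have hn : (0 : ℤ) < A.size := by exact_mod_cast h.pos
  have hb : (a + (b - a) % A.size) % A.size = b % A.size := by simp
  have hc' : (a + (c - a) % A.size) % A.size = c % A.size := by simp
  have hck := hc.congr rfl hb.symm hc'.symm
  have b1 := Int.emod_nonneg (b - a) hn.ne'
  have b2 := Int.emod_lt_of_pos (b - a) hn
  have c1 := Int.emod_nonneg (c - a) hn.ne'
  have c2 := Int.emod_lt_of_pos (c - a) hn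
  generalize (b - a) % A.size = x at *
  generalize (c - a) % A.size = y at *
  have e1 : ∀ x : ℤ, 0 ≤ x → x < A.size → k < x % A.size → k < (-x) % A.size →
      k < x ∧ x + k < A.size := by
    intro x hx hx' h1 h2
    rw [Int.emod_eq_of_lt hx hx'] at h1
    rw [← Int.add_emod_right, Int.emod_eq_of_lt (by omega) (by omega)] at h2
    omega
  obtain ⟨⟨⟨i1, i2⟩, ⟨i3, i4⟩, i5, i6⟩, -⟩ := id hck
  have f1 := e1 x b1 b2 (by convert i1 using 2; ring) (by convert i2 using 2; ring)
  have f2 := e1 y c1 c2 (by convert i3 using 2; ring) (by convert i4 using 2; ring)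
  rcases le_or_gt x y with hxy | hxy
  · have f3 := e1 (y - x) (by omega) (by omega) (by convert i5 using 2; ring)
      (by convert i6 using 2; ring)
    exact ⟨_, _, _, h.goodTriple_of_checkTriple_of_lt hck (by omega) (by omega) (by omega)⟩
  · have f3 := e1 (x - y) (by omega) (by omega) (by convert i6 using 2; ring)
      (by convert i5 using 2; ring)
    exact ⟨_, _, _, h.goodTriple_of_checkTriple_of_lt hck.swap (by omega) (by omega) (by omega)⟩

/-! ### Opposite indices -/

theorem exists_first_ge (x : ℝ) : ∃ m, α (m - 1) < x ∧ x ≤ α m := by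
  have hpi := Real.pi_pos
  obtain ⟨m, hm, hl⟩ := Int.exists_least_of_bdd (P := fun m => x ≤ α m) (by
    obtain ⟨s, hs⟩ := exists_int_lt ((x - α 0) / (2 * Real.pi))
    refine ⟨s * A.size, fun z hz => ?_⟩
    by_contra! hlt
    have h1 := h.strictMono hlt
    have h2 := h.add_mul_size 0 s
    rw [zero_add] at h2
    rw [lt_div_iff₀ (by linarith)] at hs
    linarith) (by
    obtain ⟨s, hs⟩ := exists_int_gt ((x - α 0) / (2 * Real.pi))
    refine ⟨0 + s * A.size, ?_⟩
    rw [div_lt_iff₀ (by linarith)] at hs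
    rw [h.add_mul_size]
    linarith)
  refine ⟨m, ?_, hm⟩
  by_contra! hle
  have := hl _ hle
  omega

theorem exists_isOpposite (i : ℤ) : ∃ m, IsOpposite α i m := by
  obtain ⟨m, h1, h2⟩ := h.exists_first_ge (α i + Real.pi)
  exact ⟨m, h1, h2.lt_of_ne (h.ne_opposite i m).symm⟩

theorem isOpposite_add {i m : ℤ} (hm : IsOpposite α i m) (s : ℤ) :
    IsOpposite α (i + s * A.size) (m + s * A.size) := by
  unfold IsOpposite at *
  rw [add_sub_right_comm, h.add_mul_size, h.add_mul_size, h.add_mul_size]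
  constructor <;> linarith

/-- Vectors occurring in `A` have indices with angles in any given half-open full turn. -/
theorem exists_lift (V : Finset Vec) (hV : ∀ v ∈ V, ∃ t, entry A t = v) (x : ℝ) :
    ∃ J : Finset ℤ, J.card = V.card ∧
      ∀ t ∈ J, entry A t ∈ V ∧ x ≤ α t ∧ α t < x + 2 * Real.pi := by
  classical
  have hn : (0 : ℤ) < A.size := by exact_mod_cast h.pos
  obtain ⟨N, h1, h2⟩ := h.exists_first_ge x
  refine ⟨(Finset.Ico N (N + A.size)).filter (fun t => entry A t ∈ V), ?_, ?_⟩
  · refine Finset.card_bij (fun t _ => entry A t) (fun t ht => (Finset.mem_filter.1 ht).2) ?_ ?_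
    · intro s hs t ht hst
      simp only [Finset.mem_filter, Finset.mem_Ico] at hs ht
      have hdvd : (A.size : ℤ) ∣ s - t := Int.ModEq.dvd (h.inj s t hst).symm
      have := Int.eq_zero_of_abs_lt_dvd hdvd (by rw [abs_lt]; omega)
      omega
    · intro v hv
      obtain ⟨t, rfl⟩ := hV v hv
      have b1 := Int.emod_nonneg (t - N) hn.ne'
      have b2 := Int.emod_lt_of_pos (t - N) hn
      have he : entry A (N + (t - N) % A.size) = entry A t := entry_eq_of_emod_eq A (by simp)
      refine ⟨N + (t - N) % A.size, ?_, he⟩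
      simp only [Finset.mem_filter, Finset.mem_Ico, he]
      exact ⟨by omega, hv⟩
  · intro t ht
    simp only [Finset.mem_filter, Finset.mem_Ico] at ht
    refine ⟨ht.2, h2.trans (h.strictMono.monotone ht.1.1), ?_⟩
    have h3 := h.strictMono.monotone (show t ≤ N - 1 + A.size by omega)
    rw [h.add_size] at h3
    linarith

theorem ccw_iff (s t : ℤ) :
    (ccw (entry A s) (entry A t)).val = true ↔ 0 < Real.sin (α t - α s) :=
  (h.hasAngle s).ccw_iff (h.hasAngle t)

/-- Three large sets of vectors all of whose transversals are positively oriented triangles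
around the origin yield a good triple at opposite neighbours. -/
theorem exists_goodTriple_of_ccw {k : ℕ} (V : Fin 3 → Finset Vec)
    (hV : ∀ i, ∀ v ∈ V i, ∃ t, entry A t = v) (hk : ∀ i, (V i).card = k + 1)
    (h01 : ∀ a ∈ V 0, ∀ b ∈ V 1, (ccw a b).val = true)
    (h12 : ∀ b ∈ V 1, ∀ c ∈ V 2, (ccw b c).val = true)
    (h20 : ∀ c ∈ V 2, ∀ a ∈ V 0, (ccw c a).val = true) :
    ∃ a, ∀ m m', IsOpposite α a m → IsOpposite α (a + k) m' →
      GoodTriple A.size k α a (m - 1 - k) m' := by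
  have hpi := Real.pi_pos
  have hmono := h.strictMono
  have hne : ∀ i, (V i).Nonempty := fun i => Finset.card_pos.1 (by rw [hk i]; omega)
  obtain ⟨v, hv⟩ := hne 1
  obtain ⟨β, rfl⟩ := hV 1 v hv
  obtain ⟨J₀, hJ₀, hA⟩ := h.exists_lift (V 0) (hV 0) (α β - Real.pi)
  rw [hk] at hJ₀
  have hJ₀ne : J₀.Nonempty := Finset.card_pos.1 (by omega)
  obtain ⟨a, haJ, ha⟩ := J₀.exists_min_image id hJ₀ne
  obtain ⟨a', haJ', ha'⟩ := J₀.exists_max_image id hJ₀ne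
  simp only [id] at ha ha'
  obtain ⟨J₁, hJ₁, hB⟩ := h.exists_lift (V 1) (hV 1) (α a)
  rw [hk] at hJ₁
  have hJ₁ne : J₁.Nonempty := Finset.card_pos.1 (by omega)
  obtain ⟨b, hbJ, hb⟩ := J₁.exists_min_image id hJ₁ne
  obtain ⟨J₂, hJ₂, hC⟩ := h.exists_lift (V 2) (hV 2) (α a + Real.pi)
  rw [hk] at hJ₂
  have hJ₂ne : J₂.Nonempty := Finset.card_pos.1 (by omega)
  obtain ⟨c, hcJ, hc⟩ := J₂.exists_max_image id hJ₂ne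
  simp only [id] at hb hc
  -- the angles of the three sets
  have hA' : ∀ t ∈ J₀, α t < α β := by
    intro t ht
    obtain ⟨h1, h2, h3⟩ := hA t ht
    have hs := (h.ccw_iff _ _).1 (h01 _ h1 _ hv)
    by_contra! hle
    linarith [Real.sin_nonpos_of_nonpos_of_neg_pi_le (x := α β - α t) (by linarith)
      (by linarith)]
  have hspan : α a' < α a + Real.pi := by linarith [hA' a' haJ', (hA a haJ).2.1]
  have haa' : α a ≤ α a' := hmono.monotone (ha a' haJ')
  have hB₁ : ∀ t ∈ J₁, α t < α a + Real.pi := by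
    intro t ht
    obtain ⟨h1, h2, h3⟩ := hB t ht
    have hs := (h.ccw_iff _ _).1 (h01 _ (hA a haJ).1 _ h1)
    have h4 : α t ≠ α a := fun he => by simp [he] at hs
    have := (sin_pos_iff_lt_pi (sub_pos.2 (h2.lt_of_ne' h4)) (by linarith)).1 hs
    linarith
  have hB₂ : ∀ t ∈ J₁, α a' < α t := by
    intro t ht
    obtain ⟨h1, h2, h3⟩ := hB t ht
    have hs := (h.ccw_iff _ _).1 (h01 _ (hA a' haJ').1 _ h1)
    by_contra! hle
    linarith [Real.sin_nonpos_of_nonpos_of_neg_pi_le (x := α t - α a') (by linarith)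
      (by linarith)]
  have hsin : ∀ x y, Real.sin (x - y) = -Real.sin (y - x) := fun x y => by
    rw [← Real.sin_neg, neg_sub]
  have hC₁ : ∀ t ∈ J₂, α t < α a + 2 * Real.pi := by
    intro t ht
    obtain ⟨h1, h2, h3⟩ := hC t ht
    have hs := (h.ccw_iff _ _).1 (h20 _ h1 _ (hA a haJ).1)
    by_contra! hle
    have := Real.sin_nonneg_of_nonneg_of_le_pi (x := α t - 2 * Real.pi - α a) (by linarith)
      (by linarith)
    rw [hsin, ← sub_add, Real.sin_add_two_pi] at this
    linarith
  have hC₂ : ∀ t ∈ J₂, α a' + Real.pi < α t := by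
    intro t ht
    obtain ⟨h1, h2, h3⟩ := hC t ht
    have h4 := hC₁ t ht
    have hs := (h.ccw_iff _ _).1 (h20 _ h1 _ (hA a' haJ').1)
    rw [hsin, neg_pos, sin_neg_iff_pi_lt (by linarith) (by linarith)] at hs
    linarith
  have hCB : ∀ s ∈ J₁, ∀ t ∈ J₂, α t < α s + Real.pi := by
    intro s hs t ht
    have h1 := hB₁ s hs
    have h2 := (hB s hs).2.1
    have h3 := hC₁ t ht
    have h4 := hC₂ t ht
    have hs := (h.ccw_iff _ _).1 (h12 _ (hB s hs).1 _ (hC t ht).1)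
    rw [sin_pos_iff_lt_pi (by linarith) (by linarith)] at hs
    linarith
  refine ⟨a, fun m m' hm hm' => ?_⟩
  have hlt : ∀ {s t}, α s < α t → s < t := hmono.lt_iff_lt.1
  have hcard : ∀ (J : Finset ℤ) (x y : ℤ), J.card = k + 1 → (∀ t ∈ J, x ≤ t ∧ t ≤ y) →
      x + k ≤ y := by
    intro J x y hJ hxy
    have := Finset.card_le_card (s := J) (t := Finset.Icc x y) fun t ht =>
      Finset.mem_Icc.2 (hxy t ht)
    rw [Int.card_Icc] at this
    omega
  have k₀ : a + k ≤ a' := hcard J₀ a a' hJ₀ fun t ht => ⟨ha t ht, ha' t ht⟩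
  have hak := hmono.monotone k₀
  have hak' := hmono.monotone (show a ≤ a + k by omega)
  have k₁ : b + k ≤ m - 1 := hcard J₁ b (m - 1) hJ₁ fun t ht =>
    ⟨hb t ht, Int.le_sub_one_of_lt (hlt ((hB₁ t ht).trans hm.2))⟩
  have k₂ : m' + k ≤ c := hcard J₂ m' c hJ₂ fun t ht =>
    ⟨Int.le_of_sub_one_lt (hlt (hm'.1.trans (by linarith [hC₂ t ht]))), hc t ht⟩
  have hcn : c < a + A.size := hlt (by rw [h.add_size]; exact hC₁ c hcJ)
  have hab : a' < b := hlt (hB₂ b hbJ)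
  have hmm : m - 1 < m' := hlt (by linarith [hm.1, hm'.2])
  have hck := hmono.monotone k₂
  have hbk := hmono.monotone (show b ≤ m - 1 - k by omega)
  refine ⟨by omega, by omega, by omega, ?_, ?_, ?_⟩
  · rw [sub_add_cancel]
    linarith [hm.1]
  · linarith [hCB b hbJ c hcJ]
  · linarith [hm'.2]

/-- Three large sets of vectors all of whose transversals are triangles around the origin yield a
triple that passes the check. -/
theorem exists_checkTriple {k : ℕ} (V : Fin 3 → Finset Vec)
    (hV : ∀ i, ∀ v ∈ V i, ∃ t, entry A t = v) (hk : ∀ i, (V i).card = k + 1)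
    (ht : ∀ a ∈ V 0, ∀ b ∈ V 1, ∀ c ∈ V 2, (triangleTest a b c).val = true) :
    ∃ a, ∀ m m', IsOpposite α a m → IsOpposite α (a + k) m' →
      CheckTriple A k a (m - 1 - k) m' := by
  have key : ∀ V : Fin 3 → Finset Vec, (∀ i, ∀ v ∈ V i, ∃ t, entry A t = v) →
      (∀ i, (V i).card = k + 1) →
      (∀ a ∈ V 0, ∀ b ∈ V 1, ∀ c ∈ V 2, (triangleTest a b c).val = true) →
      ∀ a₀ ∈ V 0, ∀ b₀ ∈ V 1, ∀ c₀ ∈ V 2, (ccw b₀ c₀).val = true →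
      ∃ a, ∀ m m', IsOpposite α a m → IsOpposite α (a + k) m' →
        CheckTriple A k a (m - 1 - k) m' := by
    intro V hV hk ht a₀ ha₀ b₀ hb₀ c₀ hc₀ h₀
    have hcw : ∀ u v, (ccw u v).val = true → ¬ (cw u v).val = true := fun u v h1 => by
      rw [ccw_val] at h1
      rw [cw_val]
      exact h1.not_gt
    have hall : ∀ a ∈ V 0, ∀ b ∈ V 1, ∀ c ∈ V 2,
        (ccw a b).val = true ∧ (ccw b c).val = true ∧ (ccw c a).val = true := by
      intro a ha b hb c hc
      have t1 := ((triangleTest_val _ _ _).1 (ht a ha b₀ hb₀ c₀ hc₀)).resolve_right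
        fun h2 => hcw _ _ h₀ h2.2.1
      have t2 := ((triangleTest_val _ _ _).1 (ht a ha b hb c₀ hc₀)).resolve_right
        fun h2 => hcw _ _ t1.2.2 h2.2.2
      exact ((triangleTest_val _ _ _).1 (ht a ha b hb c hc)).resolve_right
        fun h2 => hcw _ _ t2.1 h2.1
    obtain ⟨a, ha⟩ := h.exists_goodTriple_of_ccw V hV hk
      (fun a ha b hb => (hall a ha b hb c₀ hc₀).1) (fun b hb c hc => (hall a₀ ha₀ b hb c hc).2.1)
      (fun c hc a ha => (hall a ha b₀ hb₀ c hc).2.2)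
    exact ⟨a, fun m m' hm hm' => h.checkTriple_of_goodTriple (ha m m' hm hm')⟩
  have hne : ∀ i, (V i).Nonempty := fun i => Finset.card_pos.1 (by rw [hk i]; omega)
  obtain ⟨a₀, ha₀⟩ := hne 0
  obtain ⟨b₀, hb₀⟩ := hne 1
  obtain ⟨c₀, hc₀⟩ := hne 2
  rcases (triangleTest_val _ _ _).1 (ht a₀ ha₀ b₀ hb₀ c₀ hc₀) with h1 | h1
  · exact key V hV hk ht a₀ ha₀ b₀ hb₀ c₀ hc₀ h1.2.1
  · refine key ![V 0, V 2, V 1] ?_ ?_ ?_ a₀ ha₀ c₀ hc₀ b₀ hb₀ ?_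
    · intro i
      fin_cases i
      exacts [hV 0, hV 2, hV 1]
    · intro i
      fin_cases i
      exacts [hk 0, hk 2, hk 1]
    · exact fun a ha c hc b hb => (triangleTest_swap _ _ _).2 (ht a ha b hb c hc)
    · have := h1.2.1
      rw [cw_val] at this
      rw [ccw_val]
      linarith

end IsRadial

/-! ### The subroutine -/

theorem disjointIntervals_val {n k a b : ℕ} (hk : k < n) (ha : a < n) (hb : b < n) :
    (disjointIntervals a ((a + k) % n) b ((b + k) % n)).val = true ↔
      (k : ℤ) < ((b : ℤ) - a) % n ∧ (k : ℤ) < ((a : ℤ) - b) % n := by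
  have key : ∀ a b, a < n → b < n →
      ((inInterval a ((a + k) % n) b).val = false ↔ (k : ℤ) < ((b : ℤ) - a) % n) := by
    intro a b ha hb
    have e : ((b : ℤ) - a) % n = if a ≤ b then (b : ℤ) - a else b - a + n := by
      split_ifs with h
      · exact Int.emod_eq_of_lt (by omega) (by omega)
      · rw [← Int.add_emod_right, Int.emod_eq_of_lt (by omega) (by omega)]
    have e' : (a + k) % n = if a + k < n then a + k else a + k - n := by
      split_ifs with h
      · exact Nat.mod_eq_of_lt h
      · rw [Nat.mod_eq_sub_mod (by omega), Nat.mod_eq_of_lt (by omega)]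
    rw [e, ← Bool.not_eq_true]
    simp only [inInterval, natLe, boolAnd, boolOr, Timed.val_bind, Timed.val_ite, e']
    split_ifs <;> simp_all <;> omega
  rw [← key a b ha hb, ← key b a hb ha]
  simp [disjointIntervals]

theorem checkAt_size_val (A : Array Vec) (R L : Array ℕ) (i : ℕ) :
    (checkAt A R L A.size i).val = (checkAt A R L 0 i).val := by
  simp [checkAt]

theorem subroutine_val (A : Array Vec) (R L : Array ℕ) (k : ℕ) :
    (subroutine A R L k).val = true ↔ ∃ i < A.size, (checkAt A R L k i).val = true := by
  simp only [subroutine, Timed.val_bind, arraySize]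
  exact forLoop_or_val _ _

theorem subroutine_size_val (A : Array Vec) (R L : Array ℕ) :
    (subroutine A R L A.size).val = true ↔ (subroutine A R L 0).val = true := by
  simp only [subroutine_val, checkAt_size_val]

namespace IsRadial

variable {A : Array Vec} {α : ℤ → ℝ} (h : IsRadial A α)
include h

theorem size_angle : 2 * Real.pi ≤ α A.size := by
  have := h.add_size 0
  rw [zero_add] at this
  linarith [h.nonneg]

theorem rank_val {w : Vec} {φ : ℝ} (hw : HasAngle w φ) (h₀ : 0 ≤ φ) (h₁ : φ < 2 * Real.pi)
    {m : ℤ} (hm : α (m - 1) < φ) (hm' : φ < α m) : ((rank A w).val : ℤ) = m := by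
  have hlt : ∀ {s t}, α s < α t → s < t := h.strictMono.lt_iff_lt.1
  have hm0 : -1 < m := hlt (by
    have := h.sub_size (A.size - 1)
    rw [sub_sub_cancel_left] at this
    linarith [h.lt_two_pi])
  have hmn : m - 1 < A.size := hlt (by linarith [h.size_angle])
  obtain ⟨r, rfl⟩ := Int.eq_ofNat_of_zero_le (show 0 ≤ m by omega)
  simp only [rank, Timed.val_bind, arraySize, Int.natCast_inj]
  refine binarySearch_val _ _ _ _ (by omega) (by omega) fun t _ ht => ?_
  have ht₀ : α 0 ≤ α t := h.strictMono.monotone (by omega)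
  have ht₁ : α t ≤ α (A.size - 1) := h.strictMono.monotone (by omega)
  simp only [Timed.val_bind, arrayGet]
  rw [entry_natCast A ht, (h.hasAngle t).before_iff hw (by linarith [h.nonneg])
    (by linarith [h.lt_two_pi]) h₀ h₁]
  constructor
  · intro hlt'
    exact_mod_cast hlt (hlt'.trans hm')
  · intro hlt'
    exact (h.strictMono.monotone (by omega)).trans_lt hm

theorem rank_opposite_val {i : ℕ} (hi : i < A.size) {m : ℤ} (hm : IsOpposite α i m) :
    ((rank A (opposite (A.getD i default)).val).val : ℤ) % A.size = m % A.size := by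
  have hpi := Real.pi_pos
  have ho := (h.hasAngle i).opposite
  rw [entry_natCast A hi]
  have hi₀ : α 0 ≤ α i := h.strictMono.monotone (by omega)
  have hi₁ : α i ≤ α (A.size - 1) := h.strictMono.monotone (by omega)
  have h0 := h.nonneg
  have h1 := h.lt_two_pi
  rcases lt_or_ge (α i) Real.pi with hlt | hge
  · rw [h.rank_val ho (by linarith) (by linarith) hm.1 hm.2]
  · have ho' := ho.add_int_mul (-1)
    have e1 := h.sub_size m
    have e2 := h.sub_size (m - 1)
    rw [h.rank_val (m := m - A.size) ho' (by push_cast; linarith) (by push_cast; linarith)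
      (by push_cast; rw [sub_right_comm, e2]; linarith [hm.1])
      (by push_cast; rw [e1]; linarith [hm.2])]
    simp

theorem oppositeLeft_val {i : ℕ} (hi : i < A.size) {m : ℤ} (hm : IsOpposite α i m) :
    ((oppositeLeft A i).val : ℤ) = m % A.size := by
  simp only [oppositeLeft, Timed.val_bind, arraySize, arrayGet, natMod, Int.natCast_mod]
  exact h.rank_opposite_val hi hm

theorem oppositeRight_val {i : ℕ} (hi : i < A.size) {m : ℤ} (hm : IsOpposite α i m) :
    ((oppositeRight A i).val : ℤ) = (m - 1) % A.size := by
  simp only [oppositeRight, Timed.val_bind, arraySize, arrayGet, natMod, natAdd, natSub,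
    Int.natCast_mod]
  rw [Nat.cast_sub (by omega), Nat.cast_add, Nat.cast_one, add_sub_right_comm,
    Int.add_emod_right]
  exact Int.ModEq.sub_right 1 (h.rank_opposite_val hi hm)

theorem checkAt_val {R L : Array ℕ} (hR : ∀ i < A.size, R.getD i default = (oppositeRight A i).val)
    (hL : ∀ i < A.size, L.getD i default = (oppositeLeft A i).val) {i k : ℕ} (hi : i < A.size)
    (hk : k < A.size) {m m' : ℤ} (hm : IsOpposite α i m) (hm' : IsOpposite α (i + k) m') :
    (checkAt A R L k i).val = true ↔ CheckTriple A k i (m - 1 - k) m' := by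
  have hn := h.pos
  have hn' : (A.size : ℤ) ≠ 0 := by omega
  have hik : (i + k) % A.size < A.size := Nat.mod_lt _ hn
  have hm'' : IsOpposite α ((i + k) % A.size : ℕ) (m' + -((i + k : ℤ) / A.size) * A.size) := by
    have := h.isOpposite_add hm' (-((i + k : ℤ) / A.size))
    convert this using 1
    push_cast
    rw [Int.emod_def]
    ring
  obtain ⟨j, hj⟩ : ∃ j, (oppositeRight A i).val = j := ⟨_, rfl⟩
  obtain ⟨c, hc⟩ : ∃ c, (oppositeLeft A ((i + k) % A.size)).val = c := ⟨_, rfl⟩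
  have hj' := h.oppositeRight_val hi hm
  have hc' := h.oppositeLeft_val hik hm''
  rw [hj] at hj'
  rw [hc, Int.add_mul_emod_self_right] at hc'
  have hjn : j < A.size := by
    have := Int.emod_lt_of_pos (m - 1) (show (0 : ℤ) < A.size by omega)
    omega
  have hcn : c < A.size := by
    have := Int.emod_lt_of_pos m' (show (0 : ℤ) < A.size by omega)
    omega
  obtain ⟨b, hb⟩ : ∃ b, (j + A.size - k) % A.size = b := ⟨_, rfl⟩
  have hbn : b < A.size := hb ▸ Nat.mod_lt _ hn
  have hbj : j = (b + k) % A.size := by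
    rw [← hb, Nat.mod_add_mod, Nat.sub_add_cancel (by omega), Nat.add_mod_right,
      Nat.mod_eq_of_lt hjn]
  have hb' : (b : ℤ) % A.size = (m - 1 - k) % A.size := by
    have e1 : ((b + k : ℤ)) % A.size = (m - 1) % A.size := by
      rw [← hj', hbj]
      push_cast
      rfl
    have := Int.ModEq.sub_right (k : ℤ) e1
    rwa [add_sub_cancel_right] at this
  have hct : CheckTriple A k i (m - 1 - k) m' ↔ CheckTriple A k i b c := by
    have hce : (c : ℤ) % A.size = m' % A.size := by rw [hc', Int.emod_emod]
    exact ⟨fun hh => hh.congr rfl hb'.symm hce.symm, fun hh => hh.congr rfl hb' hce⟩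
  have hent : ∀ x : ℕ, A.getD ((x + k) % A.size) default = entry A (x + k) := fun x => by
    rw [entry_natCast A (Nat.mod_lt _ hn)]
    exact entry_eq_of_emod_eq A (by push_cast; rw [Int.emod_emod])
  rw [hct]
  simp only [checkAt, Timed.val_bind, arraySize, arrayGet, natMod, natAdd, natSub, boolAnd,
    Bool.and_eq_true]
  rw [hR i hi, hL _ hik, hj, hc, hb, hbj, disjointIntervals_val hk hi hbn,
    disjointIntervals_val hk hi hcn, disjointIntervals_val hk hbn hcn, triangleTest₈_val,
    hent, hent, hent, entry_natCast A hi, entry_natCast A hbn, entry_natCast A hcn, CheckTriple]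
  exact ⟨fun ⟨⟨⟨d₁, d₂⟩, d₃⟩, t⟩ => ⟨⟨d₁, d₂, d₃⟩, t⟩, fun ⟨⟨d₁, d₂, d₃⟩, t⟩ => ⟨⟨⟨d₁, d₂⟩, d₃⟩, t⟩⟩

theorem subroutine_iff {R L : Array ℕ}
    (hR : ∀ i < A.size, R.getD i default = (oppositeRight A i).val)
    (hL : ∀ i < A.size, L.getD i default = (oppositeLeft A i).val) {k : ℕ} (hk : k < A.size) :
    (subroutine A R L k).val = true ↔ ∃ a m m', IsOpposite α a m ∧ IsOpposite α (a + k) m' ∧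
      CheckTriple A k a (m - 1 - k) m' := by
  have hn : (0 : ℤ) < A.size := by exact_mod_cast h.pos
  rw [subroutine_val]
  constructor
  · rintro ⟨i, hi, hc⟩
    obtain ⟨m, hm⟩ := h.exists_isOpposite i
    obtain ⟨m', hm'⟩ := h.exists_isOpposite (i + k)
    exact ⟨i, m, m', hm, hm', (h.checkAt_val hR hL hi hk hm hm').1 hc⟩
  · rintro ⟨a, m, m', hm, hm', hc⟩
    have b1 := Int.emod_nonneg a hn.ne'
    have b2 := Int.emod_lt_of_pos a hn
    have b3 := Int.emod_def a A.size
    obtain ⟨i, hi⟩ := Int.eq_ofNat_of_zero_le b1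
    have e : (i : ℤ) = a + -(a / A.size) * A.size := by rw [← hi, b3]; ring
    refine ⟨i, by omega, (h.checkAt_val hR hL (by omega) hk
      (m := m + -(a / A.size) * A.size) (m' := m' + -(a / A.size) * A.size) ?_ ?_).2
      (hc.congr ?_ ?_ ?_)⟩
    · rw [e]
      exact h.isOpposite_add hm _
    · rw [e, add_right_comm]
      exact h.isOpposite_add hm' _
    · rw [e, Int.add_mul_emod_self_right]
    · rw [sub_sub, sub_sub, add_sub_right_comm, Int.add_mul_emod_self_right]
    · rw [Int.add_mul_emod_self_right]

end IsRadial

/-! ### Sorting yields a radial order -/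

open Classical in
/-- The polar angle in `[0, 2π)`. -/
noncomputable def angle (u : Vec) : ℝ := if h : u = 0 then 0 else (exists_hasAngle u h).choose

theorem angle_spec {u : Vec} (hu : u ≠ 0) :
    0 ≤ angle u ∧ angle u < 2 * Real.pi ∧ HasAngle u (angle u) := by
  rw [angle, dif_neg hu]
  exact (exists_hasAngle u hu).choose_spec

theorem exists_isRadial (l : List Vec) (hl : l ≠ []) (hnd : l.Nodup) (h0 : ∀ u ∈ l, u ≠ 0)
    (hcross : ∀ u ∈ l, ∀ v ∈ l, u ≠ v → u.1 * v.2 - u.2 * v.1 ≠ 0) :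
    ∃ α, IsRadial (mergeSort before l).val.toArray α := by
  have hpi := Real.pi_pos
  have hperm := mergeSort_perm before l
  have hsorted := mergeSort_pairwise before angle l fun u hu v hv => by
    obtain ⟨a1, a2, a3⟩ := angle_spec (h0 u hu)
    obtain ⟨b1, b2, b3⟩ := angle_spec (h0 v hv)
    exact a3.before_iff b3 a1 a2 b1 b2
  generalize (mergeSort before l).val = s at *
  set A := s.toArray
  have hsize : A.size = s.length := by simp [A]
  have hn : 0 < A.size := by
    rw [hsize, hperm.length_eq]
    exact List.length_pos_iff.2 hl
  have hn' : (0 : ℤ) < A.size := by exact_mod_cast hn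
  have hsnd : s.Nodup := hperm.nodup_iff.2 hnd
  have hinj : ∀ u ∈ l, ∀ v ∈ l, angle u = angle v → u = v := by
    intro u hu v hv he
    by_contra hne
    obtain ⟨c, hc, hcs⟩ := (angle_spec (h0 u hu)).2.2.cross (angle_spec (h0 v hv)).2.2
    rw [he, sub_self, Real.sin_zero, mul_zero] at hcs
    exact hcross u hu v hv hne hcs
  have hent : ∀ t : ℤ, ∃ hlt : (t % A.size).toNat < s.length,
      entry A t = s[(t % A.size).toNat] := by
    intro t
    have b1 := Int.emod_nonneg t hn'.ne'
    have b2 := Int.emod_lt_of_pos t hn'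
    have hlt : (t % A.size).toNat < s.length := by omega
    exact ⟨hlt, by rw [entry, Array.getD, dif_pos (by omega)]; rfl⟩
  have hmem : ∀ t, entry A t ∈ l := by
    intro t
    obtain ⟨hlt, he⟩ := hent t
    rw [he, ← hperm.mem_iff]
    exact List.getElem_mem hlt
  have hang : ∀ t, 0 ≤ angle (entry A t) ∧ angle (entry A t) < 2 * Real.pi ∧
      HasAngle (entry A t) (angle (entry A t)) := fun t => angle_spec (h0 _ (hmem t))
  have hstrict : ∀ t t' : ℤ, t % A.size < t' % A.size →
      angle (entry A t) < angle (entry A t') := by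
    intro t t' htt
    obtain ⟨hlt, he⟩ := hent t
    obtain ⟨hlt', he'⟩ := hent t'
    have b1 := Int.emod_nonneg t hn'.ne'
    have hij : (t % A.size).toNat < (t' % A.size).toNat := by omega
    have hle := List.pairwise_iff_getElem.1 hsorted _ _ hlt hlt' hij
    rw [← he, ← he'] at hle
    refine hle.lt_of_ne fun hangle => ?_
    have := hinj _ (hmem t) _ (hmem t') hangle
    rw [he, he', hsnd.getElem_inj_iff] at this
    omega
  have hentinj : ∀ t t', entry A t = entry A t' → t % A.size = t' % A.size := by
    intro t t' he
    rcases lt_trichotomy (t % A.size) (t' % A.size) with hlt | heq | hlt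
    · have := hstrict _ _ hlt
      rw [he] at this
      exact absurd this (lt_irrefl _)
    · exact heq
    · have := hstrict _ _ hlt
      rw [he] at this
      exact absurd this (lt_irrefl _)
  refine ⟨fun t => angle (entry A t) + (t / A.size : ℤ) * (2 * Real.pi), hn, ?_, ?_, ?_, ?_, ?_,
    hentinj, ?_⟩
  · intro t t' htt
    have hle : t / A.size ≤ t' / A.size := Int.ediv_le_ediv hn' htt.le
    have e1 := Int.emod_def t A.size
    have e2 := Int.emod_def t' A.size
    dsimp only
    rcases hle.eq_or_lt with heq | hlt
    · rw [heq]
      rw [heq] at e1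
      linarith [hstrict t t' (by omega)]
    · have : ((t / A.size : ℤ) : ℝ) + 1 ≤ (t' / A.size : ℤ) := by exact_mod_cast hlt
      nlinarith [(hang t).2.1, (hang t').1]
  · intro t
    rw [entry_eq_of_emod_eq A (Int.add_emod_right t _), Int.add_ediv_of_dvd_right dvd_rfl,
      Int.ediv_self hn'.ne']
    push_cast
    ring
  · simpa using (hang 0).1
  · rw [Int.ediv_eq_zero_of_lt (by omega) (by omega)]
    simpa using (hang _).2.1
  · exact fun t => (hang t).2.2.add_int_mul _
  · intro t t' he
    have hs := ((hang t).2.2.add_int_mul (t / A.size)).cross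
      ((hang t').2.2.add_int_mul (t' / A.size))
    rw [he, add_sub_cancel_left, Real.sin_pi] at hs
    obtain ⟨c, hc, hcs⟩ := hs
    rw [mul_zero] at hcs
    have heq : entry A t = entry A t' := by
      by_contra hne
      exact hcross _ (hmem t) _ (hmem t') hne hcs
    rw [heq] at he
    have h2 : ((2 * (t' / A.size : ℤ) : ℤ) : ℝ) = (2 * (t / A.size : ℤ) + 1 : ℤ) := by
      push_cast
      have : (2 * ((t' / A.size : ℤ) : ℝ) - (2 * ((t / A.size : ℤ) : ℝ) + 1)) * Real.pi = 0 := by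
        linear_combination he
      have := (mul_eq_zero.1 this).resolve_right hpi.ne'
      linarith
    have := Int.cast_injective h2
    omega

/-! ### The enclosing depth -/

theorem vec_injective (q : Pt 2) : Function.Injective (vec q) := by
  intro s t h
  simp only [vec, Prod.mk.injEq, sub_left_inj] at h
  ext i
  fin_cases i
  exacts [h.1, h.2]

theorem vec_ne_zero {q s : Pt 2} (h : s ≠ q) : vec q s ≠ 0 := fun h0 => h (vec_injective q (by
  rw [h0]
  simp [vec, Prod.mk_zero_zero]))

theorem cross_vec_ne_zero {q s t : Pt 2} (hs : s ≠ q) (h : ¬ Collinear ℝ {q, s, t}) :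
    (vec q s).1 * (vec q t).2 - (vec q s).2 * (vec q t).1 ≠ 0 := by
  contrapose! h
  have hv := vec_ne_zero hs
  simp only [vec, ne_eq, Prod.mk_eq_zero, not_and_or] at h hv
  suffices hr : ∃ r : ℝ, t 0 - q 0 = r * (s 0 - q 0) ∧ t 1 - q 1 = r * (s 1 - q 1) by
    obtain ⟨r, h0, h1⟩ := hr
    rw [collinear_iff_of_mem (p₀ := q) (by simp)]
    refine ⟨s - q, fun p hp => ?_⟩
    rcases hp with rfl | rfl | rfl
    · exact ⟨0, by simp⟩
    · exact ⟨1, by simp⟩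
    · refine ⟨r, ?_⟩
      ext i
      fin_cases i
      · simp [← h0]
      · simp [← h1]
  rcases hv with hv | hv
  · refine ⟨(t 0 - q 0) / (s 0 - q 0), (div_mul_cancel₀ _ hv).symm, ?_⟩
    field_simp
    linarith
  · refine ⟨(t 1 - q 1) / (s 1 - q 1), ?_, (div_mul_cancel₀ _ hv).symm⟩
    field_simp
    linarith

theorem three_mul_enclosingDepth_le (S : Finset (Pt 2)) (q : Pt 2) :
    3 * enclosingDepth S q ≤ S.card := by
  classical
  obtain ⟨T, hT, hk, hd, -⟩ := (enclosingDepth_isGreatest S q).1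
  have h1 : (Finset.univ.biUnion T).card = ∑ i, (T i).card :=
    Finset.card_biUnion fun i _ j _ hij => hd i j hij
  have h2 : (Finset.univ.biUnion T).card ≤ S.card :=
    Finset.card_le_card (Finset.biUnion_subset.2 fun i _ => hT i)
  simp only [hk, Finset.sum_const, Finset.card_univ, Fintype.card_fin, smul_eq_mul] at h1
  omega

theorem exists_kEncloses_of_le_enclosingDepth {S : Finset (Pt 2)} {q : Pt 2} {k : ℕ}
    (hk : k ≤ enclosingDepth S q) :
    ∃ T : Fin 3 → Finset (Pt 2), (∀ i, T i ⊆ S) ∧ KEncloses k T q := by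
  obtain ⟨T, hT, hc, hd, he⟩ := (enclosingDepth_isGreatest S q).1
  choose U hU hUc using fun i => Finset.exists_subset_card_eq (hk.trans_eq (hc i).symm)
  exact ⟨U, fun i => (hU i).trans (hT i), hUc,
    fun i j hij => (hd i j hij).mono (hU i) (hU j), fun p hp => he p fun i => hU i (hp i)⟩

section

variable {A : Array Vec} {α : ℤ → ℝ} (h : IsRadial A α) {S : Finset (Pt 2)} {q : Pt 2}
  (hmem : ∀ v, (∃ t, entry A t = v) ↔ ∃ p ∈ S, vec q p = v)
  (hcross : ∀ s ∈ S, ∀ t ∈ S, s ≠ t →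
    (vec q s).1 * (vec q t).2 - (vec q s).2 * (vec q t).1 ≠ 0)
include h hmem hcross

theorem IsRadial.lt_enclosingDepth_of_goodTriple {k : ℕ} {a b c : ℤ}
    (hg : GoodTriple A.size k α a b c) : k < enclosingDepth S q := by
  classical
  obtain ⟨h1, h2, h3, -⟩ := id hg
  let U : ℤ → Finset (Pt 2) := fun x =>
    S.filter fun p => ∃ t ∈ Finset.Icc x (x + k), entry A t = vec q p
  have hinj : ∀ s t : ℤ, |s - t| < A.size → entry A s = entry A t → s = t := by
    intro s t hst he
    have := Int.eq_zero_of_abs_lt_dvd (Int.ModEq.dvd (h.inj s t he).symm) hst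
    omega
  have hcard : ∀ x, (U x).card = k + 1 := by
    intro x
    have e1 : (U x).image (vec q) = (Finset.Icc x (x + k)).image (entry A) := by
      ext v
      simp only [U, Finset.mem_image, Finset.mem_filter]
      constructor
      · rintro ⟨p, ⟨-, t, ht, he⟩, rfl⟩
        exact ⟨t, ht, he⟩
      · rintro ⟨t, ht, rfl⟩
        obtain ⟨p, hp, he⟩ := (hmem _).1 ⟨t, rfl⟩
        exact ⟨p, ⟨hp, t, ht, he.symm⟩, he⟩
    rw [← Finset.card_image_of_injective _ (vec_injective q), e1, Finset.card_image_of_injOn,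
      Int.card_Icc]
    · omega
    · intro s hs t ht he
      simp only [Finset.coe_Icc, Set.mem_Icc] at hs ht
      exact hinj s t (by rw [abs_lt]; omega) he
  have hdisj : ∀ x y : ℤ, x + k < y → y + k < x + A.size → Disjoint (U x) (U y) := by
    intro x y hxy hyx
    rw [Finset.disjoint_left]
    intro p hpx hpy
    simp only [U, Finset.mem_filter, Finset.mem_Icc] at hpx hpy
    obtain ⟨-, s, hs, hs'⟩ := hpx
    obtain ⟨-, t, ht, ht'⟩ := hpy
    have := hinj s t (by rw [abs_lt]; omega) (hs'.trans ht'.symm)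
    omega
  have d1 := hdisj a b (by omega) (by omega)
  have d2 := hdisj a c (by omega) (by omega)
  have d3 := hdisj b c (by omega) (by omega)
  have hd : ∀ i j : Fin 3, i ≠ j → Disjoint (![U a, U b, U c] i) (![U a, U b, U c] j) := by
    intro i j hij
    fin_cases i <;> fin_cases j <;> first | exact absurd rfl hij | skip
    exacts [d1, d2, d1.symm, d3, d2.symm, d3.symm]
  have hsub : ∀ i : Fin 3, ![U a, U b, U c] i ⊆ S := by
    intro i
    fin_cases i <;> exact Finset.filter_subset _ _
  refine Nat.lt_of_succ_le ((enclosingDepth_isGreatest S q).2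
    ⟨![U a, U b, U c], hsub, ?_, hd, ?_⟩)
  · intro i
    fin_cases i <;> exact hcard _
  · intro p hp
    refine (mem_convexHull_range_iff_triangleTest p q fun i j hij => ?_).2 ?_
    · exact hcross _ (hsub i (hp i)) _ (hsub j (hp j)) fun he =>
        Finset.disjoint_left.1 (hd i j hij) (hp i) (he ▸ hp j)
    · obtain ⟨-, x, hx, hx'⟩ := Finset.mem_filter.1 (show p 0 ∈ U a from hp 0)
      obtain ⟨-, y, hy, hy'⟩ := Finset.mem_filter.1 (show p 1 ∈ U b from hp 1)
      obtain ⟨-, z, hz, hz'⟩ := Finset.mem_filter.1 (show p 2 ∈ U c from hp 2)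
      rw [← hx', ← hy', ← hz']
      exact h.triangleTest_of_goodTriple hg hx hy hz

theorem IsRadial.subroutine_iff_lt_enclosingDepth {R L : Array ℕ}
    (hR : ∀ i < A.size, R.getD i default = (oppositeRight A i).val)
    (hL : ∀ i < A.size, L.getD i default = (oppositeLeft A i).val) {k : ℕ} (hk : k < A.size) :
    (subroutine A R L k).val = true ↔ k < enclosingDepth S q := by
  classical
  rw [h.subroutine_iff hR hL hk]
  constructor
  · rintro ⟨a, m, m', -, -, hc⟩
    obtain ⟨a, b, c, hg⟩ := h.exists_goodTriple_of_checkTriple hc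
    exact h.lt_enclosingDepth_of_goodTriple hmem hcross hg
  · intro hlt
    obtain ⟨T, hT, hc, hd, he⟩ := exists_kEncloses_of_le_enclosingDepth (Nat.succ_le_of_lt hlt)
    obtain ⟨a, ha⟩ := h.exists_checkTriple (k := k) (fun i => (T i).image (vec q))
      (fun i v hv => by
        obtain ⟨p, hp, rfl⟩ := Finset.mem_image.1 hv
        exact (hmem _).2 ⟨p, hT i hp, rfl⟩)
      (fun i => by rw [Finset.card_image_of_injective _ (vec_injective q), hc i])
      (fun u hu v hv w hw => by
        obtain ⟨x, hx, rfl⟩ := Finset.mem_image.1 hu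
        obtain ⟨y, hy, rfl⟩ := Finset.mem_image.1 hv
        obtain ⟨z, hz, rfl⟩ := Finset.mem_image.1 hw
        have hp : ∀ i, ![x, y, z] i ∈ T i := by
          intro i
          fin_cases i
          exacts [hx, hy, hz]
        exact (mem_convexHull_range_iff_triangleTest ![x, y, z] q fun i j hij =>
          hcross _ (hT i (hp i)) _ (hT j (hp j)) fun he =>
            Finset.disjoint_left.1 (hd i j hij) (hp i) (he ▸ hp j)).1 (he _ hp))
    obtain ⟨m, hm⟩ := h.exists_isOpposite a
    obtain ⟨m', hm'⟩ := h.exists_isOpposite (a + k)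
    exact ⟨a, m, m', hm, hm', ha m m' hm hm'⟩

end

theorem binarySearch_subroutine_val {A : Array Vec} {R L : Array ℕ} {D : ℕ}
    (h : ∀ k < A.size, (subroutine A R L k).val = true ↔ k < D) (hD : 3 * D ≤ A.size) :
    (binarySearch (subroutine A R L) 0 (A.size + 1)).val = D := by
  rcases lt_or_ge A.size 2 with hn | hn
  · refine binarySearch_val _ _ _ _ (by omega) (by omega) fun k _ hk => ?_
    rcases lt_or_ge k A.size with hlt | hge
    · exact h k hlt
    · obtain rfl : k = A.size := by omega
      rw [subroutine_size_val]
      rcases Nat.eq_zero_or_pos A.size with h0 | h0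
      · simp only [subroutine_val, h0]
        simp only [not_lt_zero, false_and, exists_false, false_iff]
        omega
      · rw [h 0 h0]
        omega
  · have hm := h ((A.size + 1) / 2) (by omega)
    rw [binarySearch, if_pos (by omega)]
    simp only [Timed.val_bind, Timed.val_ite, zero_add, hm]
    rw [if_neg (by omega)]
    exact binarySearch_val _ _ _ _ (by omega) (by omega) fun k _ hk => h k (by omega)

theorem algorithm_val {S : Finset (Pt 2)} {q : Pt 2} (hq : q ∉ S)
    (hcol : ∀ s ∈ S, ∀ t ∈ S, s ≠ t → ¬ Collinear ℝ {q, s, t}) {pts : List (Pt 2)}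
    (hnd : pts.Nodup) (hpts : ∀ p, p ∈ pts ↔ p ∈ S) :
    (algorithm pts q).val = enclosingDepth S q := by
  have hcard : pts.length = S.card := by
    classical
    rw [← List.toFinset_card_of_nodup hnd]
    congr 1
    ext p
    simp [hpts]
  have hcross : ∀ s ∈ S, ∀ t ∈ S, s ≠ t →
      (vec q s).1 * (vec q t).2 - (vec q s).2 * (vec q t).1 ≠ 0 := fun s hs t ht hst =>
    cross_vec_ne_zero (fun he => hq (he ▸ hs)) (hcol s hs t ht hst)
  have hval : (centre q pts).val = pts.map (vec q) := centre_val q pts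
  have hperm := mergeSort_perm before (pts.map (vec q))
  simp only [algorithm, Timed.val_bind, hval, store_val, arraySize, natAdd, forLoop_push_val,
    Array.empty_append]
  have hrad : pts ≠ [] → ∃ α, IsRadial (mergeSort before (pts.map (vec q))).val.toArray α := by
    intro hne
    refine exists_isRadial _ (by simpa using hne) (hnd.map (vec_injective q)) ?_ ?_
    · intro u hu
      obtain ⟨p, hp, rfl⟩ := List.mem_map.1 hu
      exact vec_ne_zero fun he => hq (he ▸ (hpts p).1 hp)
    · intro u hu v hv huv
      obtain ⟨s, hs, rfl⟩ := List.mem_map.1 hu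
      obtain ⟨t, ht, rfl⟩ := List.mem_map.1 hv
      exact hcross s ((hpts s).1 hs) t ((hpts t).1 ht) fun he => huv (he ▸ rfl)
  have hsize : (mergeSort before (pts.map (vec q))).val.toArray.size = S.card := by
    simp [hperm.length_eq, hcard]
  have hmem : ∀ v, v ∈ (mergeSort before (pts.map (vec q))).val.toArray ↔
      ∃ p ∈ S, vec q p = v := by
    intro v
    simp [hperm.mem_iff, hpts]
  generalize (mergeSort before (pts.map (vec q))).val.toArray = A at *
  refine binarySearch_subroutine_val (fun k hk => ?_) ?_
  · obtain ⟨α, h⟩ := hrad (fun he => by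
      rw [he] at hcard
      simp only [List.length_nil] at hcard
      omega)
    refine h.subroutine_iff_lt_enclosingDepth (fun v => ?_) hcross ?_ ?_ hk
    · rw [← hmem]
      constructor
      · rintro ⟨t, rfl⟩
        have b1 := Int.emod_nonneg t (show (A.size : ℤ) ≠ 0 by omega)
        have b2 := Int.emod_lt_of_pos t (show (0 : ℤ) < A.size by omega)
        have hlt : (t % A.size).toNat < A.size := by omega
        rw [entry, Array.getD, dif_pos hlt]
        exact Array.getElem_mem hlt
      · intro hv
        obtain ⟨i, hi, rfl⟩ := Array.mem_iff_getElem.1 hv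
        exact ⟨i, by rw [← entry_natCast A hi, Array.getD, dif_pos hi]; rfl⟩
    · intro i hi
      simp [Array.getD, hi]
    · intro i hi
      simp [Array.getD, hi]
  · rw [hsize]
    exact three_mul_enclosingDepth_le S q

/-! ### The number of steps -/

theorem algorithm_time_le (pts : List (Pt 2)) (q : Pt 2) :
    (algorithm pts q).time ≤ 1000 * (pts.length + 1) * (Nat.clog 2 (pts.length + 2) + 1) := by
  have hlen : ∀ l : List Vec, (mergeSort before l).val.length = l.length :=
    fun l => (mergeSort_perm before l).length_eq
  have hs := mergeSort_time_le before 10 before_time_le (centre q pts).val hlen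
  have hcl : (centre q pts).val.length = pts.length := by simp [centre_val]
  rw [hcl] at hs
  obtain ⟨A, hA⟩ : ∃ A, (store #[] (mergeSort before (centre q pts).val).val).val = A := ⟨_, rfl⟩
  have hsize : A.size = pts.length := by simp [← hA, store_val, hlen, hcl]
  have hR := forLoop_time_le (fun i R => do arrayPush R (← oppositeRight A i)) #[]
    (15 * Nat.clog 2 (A.size + 1) + 10) (fun i s => by
      have := oppositeRight_time_le A i
      simp only [Timed.time_bind, arrayPush]
      omega) A.size
  have hL := forLoop_time_le (fun i R => do arrayPush R (← oppositeLeft A i)) #[]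
    (15 * Nat.clog 2 (A.size + 1) + 10) (fun i s => by
      have := oppositeLeft_time_le A i
      simp only [Timed.time_bind, arrayPush]
      omega) A.size
  have hB := fun R L => binarySearch_time_le (subroutine A R L) (290 * A.size + 2)
    (subroutine_time_le A R L) 0 (A.size + 1)
  simp only [algorithm, Timed.time_bind, hA, arraySize, natAdd, centre_time, store_time, hlen, hcl]
  have hB' := hB (forLoop (fun i R => do arrayPush R (← oppositeRight A i)) #[] A.size).val
    (forLoop (fun i R => do arrayPush R (← oppositeLeft A i)) #[] A.size).val
  rw [hsize] at *
  have c1 : Nat.clog 2 pts.length ≤ Nat.clog 2 (pts.length + 2) :=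
    Nat.clog_mono_right 2 (by omega)
  have c2 : Nat.clog 2 (pts.length + 1) ≤ Nat.clog 2 (pts.length + 2) :=
    Nat.clog_mono_right 2 (by omega)
  rw [show pts.length + 1 - 0 + 1 = pts.length + 2 from rfl] at hB'
  generalize Nat.clog 2 (pts.length + 2) = K at *
  generalize pts.length = n at *
  have m1 := Nat.mul_le_mul_left ((10 + 7) * n) c1
  have m2 := Nat.mul_le_mul_left n c2
  nlinarith

theorem clog_add_two_le {n : ℕ} (hn : 2 ≤ n) :
    (Nat.clog 2 (n + 2) : ℝ) * Real.log 2 ≤ 3 * Real.log n := by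
  have hlog2 : 0 < Real.log 2 := Real.log_pos one_lt_two
  have hn' : (2 : ℝ) ≤ n := by exact_mod_cast hn
  have hpos : 0 < Nat.clog 2 (n + 2) := Nat.clog_pos one_lt_two (by omega)
  have h1 : 2 ^ (Nat.clog 2 (n + 2) - 1) ≤ n + 2 :=
    (Nat.pow_pred_clog_lt_self one_lt_two (show 1 < n + 2 by omega)).le
  have h2 : (2 : ℝ) ^ (Nat.clog 2 (n + 2) - 1) ≤ (n : ℝ) ^ 2 := by
    calc (2 : ℝ) ^ (Nat.clog 2 (n + 2) - 1) ≤ n + 2 := by exact_mod_cast h1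
      _ ≤ (n : ℝ) ^ 2 := by nlinarith
  have h3 := Real.log_le_log (by positivity) h2
  rw [Real.log_pow, Real.log_pow, Nat.cast_sub hpos] at h3
  have h4 := Real.log_le_log two_pos hn'
  push_cast at h3
  linarith

end PlanarDepth

theorem mainTheorem1 :
    ∃ C : ℝ, ∀ (S : Finset (Pt 2)) (q : Pt 2),
      q ∉ S →
      (∀ s ∈ S, ∀ t ∈ S, s ≠ t → ¬ Collinear ℝ {q, s, t}) →
      ∀ pts : List (Pt 2), pts.Nodup → (∀ p, p ∈ pts ↔ p ∈ S) →
        (PlanarDepth.algorithm pts q).val = enclosingDepth S q ∧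
        (2 ≤ S.card →
          ((PlanarDepth.algorithm pts q).time : ℝ) ≤ C * (S.card * Real.log S.card)) := by
  refine ⟨8000 / Real.log 2, fun S q hq hcol pts hnd hpts =>
    ⟨PlanarDepth.algorithm_val hq hcol hnd hpts, fun hn => ?_⟩⟩
  have hcard : pts.length = S.card := by
    classical
    rw [← List.toFinset_card_of_nodup hnd]
    congr 1
    ext p
    simp [hpts]
  have ht := PlanarDepth.algorithm_time_le pts q
  rw [hcard] at ht
  generalize S.card = n at *
  have hlog2 : 0 < Real.log 2 := Real.log_pos one_lt_two
  have hn' : (2 : ℝ) ≤ n := by exact_mod_cast hn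
  have hlog := Real.log_le_log two_pos hn'
  have hc := PlanarDepth.clog_add_two_le hn
  have ht' : ((PlanarDepth.algorithm pts q).time : ℝ) ≤ 1000 * (n + 1) * (Nat.clog 2 (n + 2) + 1) := by
    exact_mod_cast ht
  have h4 : ((Nat.clog 2 (n + 2) : ℝ) + 1) * Real.log 2 ≤ 4 * Real.log n := by linarith
  rw [div_mul_eq_mul_div, le_div_iff₀ hlog2]
  calc ((PlanarDepth.algorithm pts q).time : ℝ) * Real.log 2
      ≤ 1000 * (n + 1) * (Nat.clog 2 (n + 2) + 1) * Real.log 2 := by gcongr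
    _ = 1000 * (n + 1) * ((Nat.clog 2 (n + 2) + 1) * Real.log 2) := by ring
    _ ≤ 1000 * (2 * n) * (4 * Real.log n) := by
        gcongr
        linarith
    _ = 8000 * (n * Real.log n) := by ring
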